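/- For $z=(x,\omega)\in\mathbb{R}^2$ let $|z|^2=x^2+\omega^2$ and $\pi(z)\phi(t)=e^{2\pi i\omega t}\phi(t-x)$. For $\phi,f\in L^2(\mathbb{R})$ let $\mathcal{V}_\phi f(z)=\langle f,\pi(z)\phi\rangle$ be the short-time Fourier transform, and for an integrable symbol $m:\mathbb{R}^2\to\mathbb{R}$ let $$H_{m,\phi}f(t)=\int_{\mathbb{R}^2}\mathcal{V}_\phi f(z)\,m(z)\,\pi(z)\phi(t)\,dz$$ be the localization operator with symbol $m$ and window $\phi$. Let $\varphi_0(t)=2^{1/4}e^{-\pi t^2}$. A family of integrable symbols $\eta_\gamma:\mathbb{R}^2\to\mathbb{R}$, $\gamma\in\Gamma\subset\mathbb{R}^2$, is called well-spread if $\Gamma$ is relatively separated (the number of points of $\Gamma$ in a closed axis-parallel unit square is bounded, uniformly over all such squares) and there is a continuous function $g\in L^2(\mathbb{R}^2)$ with $|g(z)|\le C'(1+|z|^2)^{-s'}$ for all $z$, for some constants $C'$ and $s'>1$, such that $|\eta_\gamma(\xi)|\le g(\xi-\gamma)$ for all $\xi\in\mathbb{R}^2$, $\gamma\in\Gamma$.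 Let $\phi_i\in L^2(\mathbb{R})$, $i\in\mathcal{I}$, be windows such that, for constants $C$ and $s>1$ and for all $i\in\mathcal{I}$ and $z\in\mathbb{R}^2$, $$\big(|\mathcal{V}_{\varphi_0}\phi_i|\ast|\mathcal{V}_{\varphi_0}\phi_i|\big)(z)\le C(1+|z|^2)^{-s},$$ and such that, for a constant $C_0$ with $2C_0<\|\mathcal{V}_{\varphi_0}\varphi_0\|_{L^1(\mathbb{R}^2)}$, $$|\mathcal{V}_{\varphi_0}\varphi_0(z)-\mathcal{V}_{\varphi_0}\phi_i(z)|<C_0\,|\mathcal{V}_{\varphi_0}\varphi_0(z)|\qquad\text{for all } i\in\mathcal{I},\ z\in\mathbb{R}^2.$$ Let $\{\eta_\gamma\}_{\gamma\in\Gamma}$ be a well-spread family of symbols for which there are constants $0<a\le b<\infty$ with $a\le\sum_{\gamma\in\Gamma}\eta_\gamma(z)\le b$ for all $z\in\mathbb{R}^2$, and let an index $i(\gamma)\in\mathcal{I}$ be chosen for every $\gamma\in\Gamma$. Then $H_{\eta_\gamma,\phi_{i(\gamma)}}f\in L^2(\mathbb{R})$ for all $\gamma\in\Gamma$ and $f\in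 L^2(\mathbb{R})$, and there are constants $A,B>0$ such that $$A\|f\|_2^2\le\sum_{\gamma\in\Gamma}\|H_{\eta_\gamma,\phi_{i(\gamma)}}f\|_2^2\le B\|f\|_2^2\qquad\text{for all } f\in L^2(\mathbb{R}).$$ -/

import Mathlib

open MeasureTheory
open scoped ENNReal

noncomputable section

/-- The squared Euclidean length of a point of the time-frequency plane
(the product `ℝ × ℝ` itself carries the sup norm). -/
def sqLen (z : ℝ × ℝ) : ℝ := z.1 ^ 2 + z.2 ^ 2

/-- The time-frequency shift `π(x, ω) φ (t) = e^{2 π i ω t} φ (t - x)`. -/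
def tfShift (z : ℝ × ℝ) (φ : ℝ → ℂ) (t : ℝ) : ℂ :=
  Complex.exp (2 * Real.pi * Complex.I * z.2 * t) * φ (t - z.1)

/-- The short-time Fourier transform `V_φ f (z) = ⟨f, π(z) φ⟩`,
with the inner product of `L²(ℝ)` linear in the first entry. -/
def stft (φ f : ℝ → ℂ) (z : ℝ × ℝ) : ℂ :=
  ∫ t : ℝ, f t * (starRingEnd ℂ) (tfShift z φ t)

/-- The time-frequency localization operator
`H_{m,φ} f (t) = ∫ V_φ f (z) m(z) π(z) φ (t) dz`. For an integrable symbol `m` and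
`φ, f ∈ L²(ℝ)` the integral converges absolutely for almost every `t`. -/
def locOp (m : ℝ × ℝ → ℝ) (φ f : ℝ → ℂ) (t : ℝ) : ℂ :=
  ∫ z : ℝ × ℝ, stft φ f z * (m z : ℂ) * tfShift z φ t

/-- The standard Gaussian `φ₀(t) = 2^{1/4} e^{-π t²}`. -/
def gaussWindow (t : ℝ) : ℂ :=
  (((2 : ℝ) ^ (1 / 4 : ℝ) * Real.exp (-Real.pi * t ^ 2) : ℝ) : ℂ)

/-- `Γ` is relatively separated: the number of its points in a closed unit square is bounded,
uniformly in the position of the square. -/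
def RelativelySeparated (Γ : Set (ℝ × ℝ)) : Prop :=
  ∃ N : ℕ, ∀ z : ℝ × ℝ, (Γ ∩ Set.Icc z (z + (1, 1))).encard ≤ N

/-- A well-spread family of real symbols `η γ ∈ L¹(ℝ²)`, `γ ∈ Γ`. -/
structure WellSpread (Γ : Set (ℝ × ℝ)) (η : Γ → ℝ × ℝ → ℝ) : Prop where
  integrable : ∀ γ : Γ, Integrable (η γ) volume
  relativelySeparated : RelativelySeparated Γ
  envelope : ∃ g : ℝ × ℝ → ℝ, Continuous g ∧ MemLp g 2 volume ∧
    (∃ C s : ℝ, 1 < s ∧ ∀ z, |g z| ≤ C * (1 + sqLen z) ^ (-s)) ∧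
    ∀ (γ : Γ) (ξ : ℝ × ℝ), |η γ ξ| ≤ g (ξ - γ)

/-- The convolution `|F| ∗ |F|` on the time-frequency plane. -/
def absConv (F : ℝ × ℝ → ℂ) : ℝ × ℝ → ℝ :=
  convolution (fun w => ‖F w‖) (fun w => ‖F w‖) (ContinuousLinearMap.mul ℝ ℝ) volume

end

open Filter Topology

/-! ### Square integrability in terms of lower integrals -/

section L2

variable {α : Type*} [MeasurableSpace α] {μ : Measure α}

/-! The closeness condition is rigid. The short-time Fourier transform with Gaussian window is a
fixed nonvanishing factor times a Bargmann transform, an entire function of `x - iω`, and the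
Bargmann transform of the Gaussian is a zero-free exponential. A window whose transform is dominated
by that of the Gaussian therefore gives a bounded entire quotient, which is constant by Liouville.
Since the transform is injective (Moyal), every window is a multiple `c • gaussWindow`
(`exists_ae_eq_smul_gaussWindow`). The `L¹` norm of the Gaussian's transform is 2, so `‖1 - c‖ < C₀
< 1` and `1 - C₀ ≤ ‖c‖ ≤ 2`. As the operator scales by `‖c‖ ^ 2`, only the Gaussian window remains
to be treated.

For that window write `F` for the transform of `f` and `H γ` for the operator with symbol `η γ`.
Moyal's identity gives `⟨H γ f, h⟩ = ∫ F (η γ) conj (V h)`. Duality yields the upper bound, because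
`∑ |η γ|`, hence `∑ |η γ|²`, is bounded uniformly.

For the lower bound, `∑ ⟨H γ f, f⟩ = ∫ (∑ η γ) |F|² ≥ a ‖f‖²`. Each pairing is also `∫ V(H γ f) conj
F`, which is split according to whether `w` is near `γ` or not. Near `γ`, Young's inequality gives
`δ⁻¹ ‖H γ f‖²` plus `δ` times the local energy of `F`, and the neighbourhoods overlap boundedly. Far
from `γ`, the decay of the envelope and of the Gaussian's transform, with Schur's test, makes the
total a small multiple of `‖f‖²`. For a large radius and small `δ` both errors are absorbed into `a
‖f‖²`, which leaves a bound for `∑ ‖H γ f‖²` (`exists_mul_le_tsum_lintegral_sq_locOp`). -/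

theorem eLpNorm_two_sq (f : α → ℂ) : eLpNorm f 2 μ ^ 2 = ∫⁻ x, ‖f x‖ₑ ^ 2 ∂μ := by
  have h := eLpNorm_nnreal_pow_eq_lintegral (f := f) (μ := μ) (p := 2) two_ne_zero
  simpa using h

theorem MeasureTheory.MemLp.lintegral_sq_lt_top {f : α → ℂ} (hf : MemLp f 2 μ) :
    ∫⁻ x, ‖f x‖ₑ ^ 2 ∂μ < ∞ := by
  rw [← eLpNorm_two_sq]
  exact ENNReal.pow_lt_top hf.2

theorem memLp_two_of_lintegral_sq {f : α → ℂ} (hf : AEStronglyMeasurable f μ)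
    (h : ∫⁻ x, ‖f x‖ₑ ^ 2 ∂μ < ∞) : MemLp f 2 μ := by
  refine ⟨hf, ?_⟩
  rw [← eLpNorm_two_sq] at h
  by_contra hc
  rw [not_lt, top_le_iff] at hc
  simp [hc] at h

/-- Products of two square integrable functions are integrable. -/
theorem MeasureTheory.MemLp.integrable_mul_two {f g : α → ℂ} (hf : MemLp f 2 μ)
    (hg : MemLp g 2 μ) : Integrable (fun x => f x * g x) μ :=
  hf.integrable_mul hg

theorem MeasureTheory.MemLp.conj {f : α → ℂ} {p : ℝ≥0∞} (hf : MemLp f p μ) :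
    MemLp (fun x => (starRingEnd ℂ) (f x)) p μ :=
  hf.star

/-- A bounded integrable function is square integrable. -/
theorem memLp_two_of_bounded {f : α → ℂ} (hf : Integrable f μ) {C : ℝ} (hC : ∀ x, ‖f x‖ ≤ C) :
    MemLp f 2 μ := by
  refine (memLp_two_iff_integrable_sq_norm hf.1).2 ?_
  refine (hf.norm.const_mul C).mono' (hf.1.norm.pow 2) (.of_forall fun x => ?_)
  rw [norm_pow, norm_norm, sq]
  exact mul_le_mul_of_nonneg_right (hC x) (norm_nonneg _)

end L2

/-! ### Plancherel's theorem for the integral Fourier transform -/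

section Plancherel

open scoped FourierTransform SchwartzMap ContDiff

/-- The integral Fourier transform of an `L¹ ∩ L²` function represents its `L²` Fourier
transform. -/
theorem fourier_ae_eq_fourier_toLp {g : ℝ → ℂ} (h1 : Integrable g) (h2 : MemLp g 2) :
    (𝓕 g) =ᵐ[volume] (𝓕 (h2.toLp g) : Lp ℂ 2 (volume : Measure ℝ)) := by
  have hc : Continuous (𝓕 g) :=
    VectorFourier.fourierIntegral_continuous Real.continuous_fourierChar
      (L := innerₗ ℝ) continuous_inner h1
  -- Both sides are locally integrable, so it suffices to test against smooth compactly supported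
  -- `ψ`. On either side the Fourier transform can be moved onto `ψ`, as a tempered distribution or
  -- by Fubini.
  refine ae_eq_of_integral_contDiff_smul_eq hc.locallyIntegrable
    ((Lp.memLp _).locallyIntegrable (by norm_num)) fun ψ hψ hψc => ?_
  have hc₁ : HasCompactSupport (Complex.ofRealCLM ∘ ψ) := hψc.comp_left rfl
  have hc₂ : ContDiff ℝ ∞ (Complex.ofRealCLM ∘ ψ) := by fun_prop
  set Ψ : 𝓢(ℝ, ℂ) := hc₁.toSchwartzMap hc₂ with hΨ
  have hval : ∀ x, Ψ x = (ψ x : ℂ) := fun x => rfl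
  have key : Lp.toTemperedDistribution (𝓕 (h2.toLp g) : Lp ℂ 2 (volume : Measure ℝ)) Ψ
      = Lp.toTemperedDistribution (h2.toLp g) (𝓕 Ψ) := by
    rw [← Lp.fourier_toTemperedDistribution_eq]
    rfl
  rw [Lp.toTemperedDistribution_apply, Lp.toTemperedDistribution_apply] at key
  have e1 : ∫ x, ψ x • 𝓕 g x = ∫ x, Ψ x • 𝓕 g x := by
    simp [hval]
  have e2 : ∫ x, ψ x • (𝓕 (h2.toLp g) : Lp ℂ 2 (volume : Measure ℝ)) x
      = ∫ x, Ψ x • (𝓕 (h2.toLp g) : Lp ℂ 2 (volume : Measure ℝ)) x := by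
    simp [hval]
  rw [e1, e2, key]
  have e3 : ∫ x, (𝓕 Ψ) x • (h2.toLp g) x = ∫ x, (𝓕 Ψ) x • g x := by
    refine integral_congr_ae ?_
    filter_upwards [h2.coeFn_toLp] with x hx
    rw [hx]
  rw [e3]
  have := VectorFourier.integral_fourierIntegral_smul_eq_flip (L := innerₗ ℝ) (μ := volume)
    (ν := volume) Real.continuous_fourierChar continuous_inner Ψ.integrable h1
  simpa using! this.symm

/-- Plancherel's theorem for `L¹ ∩ L²`. -/
theorem lintegral_sq_fourier {g : ℝ → ℂ} (h1 : Integrable g) (h2 : MemLp g 2) :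
    ∫⁻ x, ‖(𝓕 g) x‖ₑ ^ 2 = ∫⁻ x, ‖g x‖ₑ ^ 2 := by
  rw [← eLpNorm_two_sq, ← eLpNorm_two_sq, eLpNorm_congr_ae (fourier_ae_eq_fourier_toLp h1 h2),
    ← eLpNorm_congr_ae h2.coeFn_toLp, ← Lp.enorm_def, ← Lp.enorm_def]
  congr 1
  rw [← ofReal_norm, ← ofReal_norm, Lp.norm_fourier_eq]

end Plancherel

/-! ### The Gaussian and its normalization -/

section Gaussian

theorem gaussWindow_norm (t : ℝ) :
    ‖gaussWindow t‖ = (2 : ℝ) ^ (1 / 4 : ℝ) * Real.exp (-Real.pi * t ^ 2) := by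
  rw [gaussWindow, Complex.norm_real, Real.norm_of_nonneg (by positivity)]

theorem gaussWindow_conj (t : ℝ) : (starRingEnd ℂ) (gaussWindow t) = gaussWindow t :=
  Complex.conj_ofReal _

theorem continuous_gaussWindow : Continuous gaussWindow := by
  unfold gaussWindow
  fun_prop

theorem integrable_gaussWindow : Integrable gaussWindow :=
  ((integrable_exp_neg_mul_sq Real.pi_pos).const_mul _).ofReal

theorem gaussWindow_norm_le (t : ℝ) : ‖gaussWindow t‖ ≤ 2 := by
  rw [gaussWindow_norm]
  have h1 : (2 : ℝ) ^ (1 / 4 : ℝ) ≤ 2 ^ (1 : ℝ) :=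
    Real.rpow_le_rpow_of_exponent_le (by norm_num) (by norm_num)
  have h2 : Real.exp (-Real.pi * t ^ 2) ≤ 1 := by
    rw [Real.exp_le_one_iff]
    nlinarith [Real.pi_pos, sq_nonneg t]
  calc _ ≤ (2 : ℝ) ^ (1 : ℝ) * 1 := by gcongr
    _ = 2 := by norm_num

theorem memLp_gaussWindow : MemLp gaussWindow 2 volume :=
  memLp_two_of_bounded integrable_gaussWindow gaussWindow_norm_le

theorem gaussWindow_norm_sq (t : ℝ) :
    ‖gaussWindow t‖ ^ 2 = (2 : ℝ) ^ (1 / 2 : ℝ) * Real.exp (-(2 * Real.pi) * t ^ 2) := by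
  rw [gaussWindow_norm, mul_pow, ← Real.exp_nat_mul, ← Real.rpow_natCast, ← Real.rpow_mul (by simp)]
  norm_num
  ring_nf

theorem lintegral_sq_gaussWindow : ∫⁻ t, ‖gaussWindow t‖ₑ ^ 2 = 1 := by
  have h : ∀ t, ‖gaussWindow t‖ₑ ^ 2 = ENNReal.ofReal (‖gaussWindow t‖ ^ 2) := fun t => by
    rw [ENNReal.ofReal_pow (norm_nonneg _), ofReal_norm]
  simp_rw [h]
  rw [← ofReal_integral_eq_lintegral_ofReal
    ((memLp_two_iff_integrable_sq_norm memLp_gaussWindow.1).1 memLp_gaussWindow)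
    (.of_forall fun t => by positivity)]
  simp_rw [gaussWindow_norm_sq]
  rw [integral_const_mul, integral_gaussian, ← ENNReal.ofReal_one]
  congr 1
  rw [Real.sqrt_eq_rpow, ← Real.mul_rpow (by positivity) (by positivity)]
  rw [show 2 * (Real.pi / (2 * Real.pi)) = 1 by field_simp]
  simp

theorem lintegral_sq_gaussWindow_sub (t : ℝ) : ∫⁻ x, ‖gaussWindow (t - x)‖ₑ ^ 2 = 1 := by
  rw [lintegral_sub_left_eq_self (fun x => ‖gaussWindow x‖ₑ ^ 2) t, lintegral_sq_gaussWindow]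

end Gaussian

/-! ### Time-frequency shifts -/

section Shift

theorem norm_tfShift (z : ℝ × ℝ) (φ : ℝ → ℂ) (t : ℝ) : ‖tfShift z φ t‖ = ‖φ (t - z.1)‖ := by
  rw [tfShift, norm_mul]
  rw [show 2 * (Real.pi : ℂ) * Complex.I * z.2 * t = ((2 * Real.pi * z.2 * t : ℝ) : ℂ) * Complex.I by
    push_cast; ring, Complex.norm_exp_ofReal_mul_I, one_mul]

theorem continuous_tfShift_gaussWindow :
    Continuous fun p : (ℝ × ℝ) × ℝ => tfShift p.1 gaussWindow p.2 := by
  unfold tfShift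
  have := continuous_gaussWindow
  fun_prop

theorem memLp_tfShift (z : ℝ × ℝ) {φ : ℝ → ℂ} {p : ℝ≥0∞} (hφ : MemLp φ p volume) :
    MemLp (tfShift z φ) p volume := by
  have h : MemLp (fun t => φ (t - z.1)) p volume :=
    hφ.comp_measurePreserving (measurePreserving_sub_right volume z.1)
  refine h.of_le ?_ (.of_forall fun t => (norm_tfShift z φ t).le)
  exact (Continuous.aestronglyMeasurable (by fun_prop)).mul h.1

theorem integrable_stft {f φ : ℝ → ℂ} (hf : MemLp f 2 volume) (hφ : MemLp φ 2 volume)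
    (z : ℝ × ℝ) : Integrable fun t => f t * (starRingEnd ℂ) (tfShift z φ t) :=
  hf.integrable_mul_two (memLp_tfShift z hφ).conj

end Shift

/-! ### Moyal's identity -/

section Moyal

open scoped FourierTransform

/-- For a fixed position the transform is a Fourier transform in the frequency, which lets
Plancherel be applied slice by slice. -/
theorem stft_gaussWindow_eq_fourier (f : ℝ → ℂ) (z : ℝ × ℝ) :
    stft gaussWindow f z = 𝓕 (fun t => f t * gaussWindow (t - z.1)) z.2 := by
  rw [Real.fourier_real_eq_integral_exp_smul, stft]
  refine integral_congr_ae (.of_forall fun t => ?_)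
  simp only [tfShift, map_mul, gaussWindow_conj, ← Complex.exp_conj, smul_eq_mul]
  rw [mul_comm, mul_assoc, mul_comm (gaussWindow _)]
  congr 2
  simp only [Complex.conj_ofReal, Complex.conj_I, Complex.conj_ofNat]
  push_cast
  ring

theorem aestronglyMeasurable_stft {f : ℝ → ℂ} (hf : AEStronglyMeasurable f volume) :
    AEStronglyMeasurable (stft gaussWindow f) volume := by
  have h : AEStronglyMeasurable (fun p : (ℝ × ℝ) × ℝ =>
      f p.2 * (starRingEnd ℂ) (tfShift p.1 gaussWindow p.2)) (volume.prod volume) :=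
    hf.comp_snd.mul
      (Complex.continuous_conj.comp continuous_tfShift_gaussWindow).aestronglyMeasurable
  exact h.integral_prod_right'

/-- Moyal's identity for the Gaussian window. -/
theorem lintegral_sq_stft {f : ℝ → ℂ} (hf : MemLp f 2 volume) :
    ∫⁻ z, ‖stft gaussWindow f z‖ₑ ^ 2 = ∫⁻ t, ‖f t‖ₑ ^ 2 := by
  have hm := (aestronglyMeasurable_stft hf.1).enorm.pow_const 2
  have hg : Measurable gaussWindow := continuous_gaussWindow.measurable
  rw [Measure.volume_eq_prod, lintegral_prod _ hm]
  calc ∫⁻ x, ∫⁻ w, ‖stft gaussWindow f (x, w)‖ₑ ^ 2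
      = ∫⁻ x, ∫⁻ t, ‖f t‖ₑ ^ 2 * ‖gaussWindow (t - x)‖ₑ ^ 2 := by
        refine lintegral_congr fun x => ?_
        have hgx : MemLp (fun t => gaussWindow (t - x)) 2 volume :=
          memLp_gaussWindow.comp_measurePreserving (measurePreserving_sub_right volume x)
        simp_rw [stft_gaussWindow_eq_fourier, ← mul_pow, ← enorm_mul]
        refine lintegral_sq_fourier (hf.integrable_mul_two hgx) ?_
        -- The Gaussian is bounded by 2, so the windowed function is in `L²` as well as in `L¹`, as
        -- Plancherel needs here.
        refine (hf.const_mul 2).of_le (hf.1.mul hgx.1) (.of_forall fun t => ?_)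
        rw [norm_mul, norm_mul, mul_comm]
        gcongr
        simpa using gaussWindow_norm_le (t - x)
    _ = ∫⁻ t, ∫⁻ x, ‖f t‖ₑ ^ 2 * ‖gaussWindow (t - x)‖ₑ ^ 2 := by
        refine lintegral_lintegral_swap (AEMeasurable.mul (f := fun p : ℝ × ℝ => ‖f p.2‖ₑ ^ 2)
          (g := fun p : ℝ × ℝ => ‖gaussWindow (p.2 - p.1)‖ₑ ^ 2) ?_ ?_)
        · exact (hf.1.comp_snd (μ := volume)).enorm.pow_const 2
        · exact Measurable.aemeasurable (by fun_prop)
    _ = _ := by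
        refine lintegral_congr fun t => ?_
        rw [lintegral_const_mul _ (by fun_prop), lintegral_sq_gaussWindow_sub, mul_one]

theorem memLp_stft {f : ℝ → ℂ} (hf : MemLp f 2 volume) : MemLp (stft gaussWindow f) 2 volume :=
  memLp_two_of_lintegral_sq (aestronglyMeasurable_stft hf.1)
    ((lintegral_sq_stft hf).trans_lt hf.lintegral_sq_lt_top)

theorem stft_congr_ae {f g φ : ℝ → ℂ} (h : f =ᵐ[volume] g) : stft φ f = stft φ g := by
  ext z
  refine integral_congr_ae ?_
  filter_upwards [h] with t ht
  rw [ht]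

theorem stft_add {f g φ : ℝ → ℂ} (hf : MemLp f 2 volume) (hg : MemLp g 2 volume)
    (hφ : MemLp φ 2 volume) : stft φ (f + g) = stft φ f + stft φ g := by
  ext z
  simp only [stft, Pi.add_apply, add_mul]
  exact integral_add (integrable_stft hf hφ z) (integrable_stft hg hφ z)

theorem stft_smul (f φ : ℝ → ℂ) (c : ℂ) : stft φ (c • f) = c • stft φ f := by
  ext z
  simp only [stft, Pi.smul_apply, smul_eq_mul, mul_assoc, integral_const_mul]

/-- The short-time Fourier transform with Gaussian window as an isometry of `L²` spaces. -/
noncomputable def stftIsometry : Lp ℂ 2 (volume : Measure ℝ) →ₗᵢ[ℂ] Lp ℂ 2 (volume : Measure (ℝ × ℝ)) where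
  toFun f := (memLp_stft (Lp.memLp f)).toLp _
  map_add' f g := by
    rw [← MemLp.toLp_add]
    refine MemLp.toLp_congr _ _ (.of_forall fun z => ?_)
    rw [stft_congr_ae (Lp.coeFn_add f g), stft_add (Lp.memLp f) (Lp.memLp g) memLp_gaussWindow]
  map_smul' c f := by
    rw [RingHom.id_apply, ← MemLp.toLp_const_smul]
    refine MemLp.toLp_congr _ _ (.of_forall fun z => ?_)
    rw [stft_congr_ae (Lp.coeFn_smul c f), stft_smul]
  norm_map' f := by
    refine (Lp.norm_toLp _ (memLp_stft (Lp.memLp f))).trans ?_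
    rw [Lp.norm_def]
    congr 1
    refine (ENNReal.pow_right_strictMono two_ne_zero).injective ?_
    simp only [eLpNorm_two_sq]
    exact lintegral_sq_stft (Lp.memLp f)

/-- The polarized form of Moyal's identity. -/
theorem integral_stft_mul_conj {f h : ℝ → ℂ} (hf : MemLp f 2 volume) (hh : MemLp h 2 volume) :
    ∫ z, stft gaussWindow f z * (starRingEnd ℂ) (stft gaussWindow h z)
      = ∫ t, f t * (starRingEnd ℂ) (h t) := by
  have key := stftIsometry.inner_map_map (hh.toLp h) (hf.toLp f)
  rw [L2.inner_def, L2.inner_def] at key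
  have e1 : ∀ {u : ℝ → ℂ} (hu : MemLp u 2 volume),
      (stftIsometry (hu.toLp u)) =ᵐ[volume] stft gaussWindow u := fun hu => by
    refine (MemLp.coeFn_toLp (memLp_stft (Lp.memLp (hu.toLp _)))).trans ?_
    rw [stft_congr_ae hu.coeFn_toLp]
  refine (Eq.trans ?_ key).trans ?_
  · refine integral_congr_ae ?_
    filter_upwards [e1 hf, e1 hh] with z h1 h2
    rw [h1, h2, RCLike.inner_apply]
  · refine integral_congr_ae ?_
    filter_upwards [hf.coeFn_toLp, hh.coeFn_toLp] with z h1 h2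
    rw [h1, h2, RCLike.inner_apply]

end Moyal

/-! ### Localization operators with Gaussian window -/

section LocOp

theorem ENNReal.mul_le_sq_add_sq (a b : ℝ≥0∞) : a * b ≤ a ^ 2 + b ^ 2 := by
  rcases le_total a b with h | h
  · exact (mul_le_mul_left h b).trans (by rw [← sq]; exact le_add_self)
  · exact (mul_le_mul_right h a).trans (by rw [← sq]; exact le_self_add)

theorem enorm_tfShift (z : ℝ × ℝ) (φ : ℝ → ℂ) (t : ℝ) : ‖tfShift z φ t‖ₑ = ‖φ (t - z.1)‖ₑ := by
  rw [← ofReal_norm, norm_tfShift, ofReal_norm]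

/-- A crude substitute for Cauchy–Schwarz: only a finite bound uniform in `z` is needed, to justify
Fubini and the boundedness of the transform. -/
theorem lintegral_enorm_mul_tfShift_le {h : ℝ → ℂ} (hh : AEStronglyMeasurable h volume)
    (z : ℝ × ℝ) :
    ∫⁻ t, ‖h t‖ₑ * ‖tfShift z gaussWindow t‖ₑ ≤ (∫⁻ t, ‖h t‖ₑ ^ 2) + 1 := by
  calc ∫⁻ t, ‖h t‖ₑ * ‖tfShift z gaussWindow t‖ₑ
      ≤ ∫⁻ t, (‖h t‖ₑ ^ 2 + ‖gaussWindow (t - z.1)‖ₑ ^ 2) := by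
        refine lintegral_mono fun t => ?_
        rw [enorm_tfShift]
        exact ENNReal.mul_le_sq_add_sq _ _
    _ = _ := by
        rw [lintegral_add_left' (hh.enorm.pow_const 2),
          lintegral_sub_right_eq_self (fun t => ‖gaussWindow t‖ₑ ^ 2), lintegral_sq_gaussWindow]

theorem enorm_stft_le {f : ℝ → ℂ} (hf : AEStronglyMeasurable f volume) (z : ℝ × ℝ) :
    ‖stft gaussWindow f z‖ₑ ≤ (∫⁻ t, ‖f t‖ₑ ^ 2) + 1 := by
  refine (enorm_integral_le_lintegral_enorm _).trans ?_
  simp_rw [enorm_mul, RCLike.enorm_conj]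
  exact lintegral_enorm_mul_tfShift_le hf z

theorem integrable_stft_mul {f : ℝ → ℂ} (hf : MemLp f 2 volume) {m : ℝ × ℝ → ℝ}
    (hm : Integrable m volume) :
    Integrable (fun z => stft gaussWindow f z * (m z : ℂ)) volume := by
  have hfin : (∫⁻ t, ‖f t‖ₑ ^ 2) + 1 ≠ ∞ :=
    ENNReal.add_ne_top.2 ⟨hf.lintegral_sq_lt_top.ne, ENNReal.one_ne_top⟩
  refine hm.ofReal.bdd_mul (c := ((∫⁻ t, ‖f t‖ₑ ^ 2) + 1).toReal) (aestronglyMeasurable_stft hf.1)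
    (.of_forall fun z => ?_)
  rw [← toReal_enorm]
  exact ENNReal.toReal_mono hfin (enorm_stft_le hf.1 z)

theorem integrable_locOp_kernel_mul {f h : ℝ → ℂ} (hf : MemLp f 2 volume) (hh : MemLp h 2 volume)
    {m : ℝ × ℝ → ℝ} (hm : Integrable m volume) :
    Integrable (fun p : (ℝ × ℝ) × ℝ => stft gaussWindow f p.1 * (m p.1 : ℂ) *
      tfShift p.1 gaussWindow p.2 * (starRingEnd ℂ) (h p.2)) (volume.prod volume) := by
  have hF := integrable_stft_mul hf hm
  have hmeas : AEStronglyMeasurable (fun p : (ℝ × ℝ) × ℝ => stft gaussWindow f p.1 * (m p.1 : ℂ) *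
      tfShift p.1 gaussWindow p.2 * (starRingEnd ℂ) (h p.2)) (volume.prod volume) :=
    (hF.1.comp_fst.mul continuous_tfShift_gaussWindow.aestronglyMeasurable).mul hh.conj.1.comp_snd
  refine ⟨hmeas, ?_⟩
  rw [HasFiniteIntegral, lintegral_prod _ hmeas.enorm]
  have hfin : (∫⁻ t, ‖h t‖ₑ ^ 2) + 1 < ∞ :=
    ENNReal.add_lt_top.2 ⟨hh.lintegral_sq_lt_top, ENNReal.one_lt_top⟩
  calc _ ≤ ∫⁻ z, ‖stft gaussWindow f z * (m z : ℂ)‖ₑ * ((∫⁻ t, ‖h t‖ₑ ^ 2) + 1) := by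
        refine lintegral_mono fun z => ?_
        simp_rw [enorm_mul (_ * _) ((starRingEnd ℂ) _), enorm_mul _ (tfShift _ _ _),
          RCLike.enorm_conj, mul_assoc]
        rw [lintegral_const_mul' _ _ (by finiteness)]
        gcongr
        simp_rw [mul_comm ‖tfShift _ _ _‖ₑ]
        exact lintegral_enorm_mul_tfShift_le hh.1 z
    _ < ∞ := by
        rw [lintegral_mul_const' _ _ hfin.ne]
        exact ENNReal.mul_lt_top hF.2 hfin

/-- The weak form of the localization operator. -/
theorem integral_locOp_mul_conj {f h : ℝ → ℂ} (hf : MemLp f 2 volume) (hh : MemLp h 2 volume)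
    {m : ℝ × ℝ → ℝ} (hm : Integrable m volume) :
    ∫ t, locOp m gaussWindow f t * (starRingEnd ℂ) (h t)
      = ∫ z, stft gaussWindow f z * (m z : ℂ) * (starRingEnd ℂ) (stft gaussWindow h z) := by
  simp_rw [locOp, ← integral_mul_const]
  rw [← integral_integral_swap (integrable_locOp_kernel_mul hf hh hm)]
  refine integral_congr_ae (.of_forall fun z => ?_)
  simp only [stft, ← integral_conj, map_mul, Complex.conj_conj, ← integral_const_mul]
  refine integral_congr_ae (.of_forall fun t => ?_)
  simp only
  ring

/-- The Gaussian is both integrable and bounded, so the output is in `L¹` and bounded, hence in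
`L²`. -/
theorem memLp_locOp {f : ℝ → ℂ} (hf : MemLp f 2 volume) {m : ℝ × ℝ → ℝ}
    (hm : Integrable m volume) : MemLp (locOp m gaussWindow f) 2 volume := by
  have hF := integrable_stft_mul hf hm
  have hg : Continuous gaussWindow := continuous_gaussWindow
  have hmeas : AEStronglyMeasurable (fun p : (ℝ × ℝ) × ℝ => stft gaussWindow f p.1 * (m p.1 : ℂ) *
      tfShift p.1 gaussWindow p.2) (volume.prod volume) :=
    hF.1.comp_fst.mul continuous_tfShift_gaussWindow.aestronglyMeasurable
  have hint : Integrable (fun p : (ℝ × ℝ) × ℝ => stft gaussWindow f p.1 * (m p.1 : ℂ) *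
      tfShift p.1 gaussWindow p.2) (volume.prod volume) := by
    refine ⟨hmeas, ?_⟩
    rw [HasFiniteIntegral, lintegral_prod _ hmeas.enorm]
    simp_rw [enorm_mul _ (tfShift _ _ _), enorm_tfShift]
    calc _ = ∫⁻ z, ‖stft gaussWindow f z * (m z : ℂ)‖ₑ * (∫⁻ t, ‖gaussWindow t‖ₑ) := by
          refine lintegral_congr fun z => ?_
          rw [lintegral_const_mul' _ _ (by finiteness),
            lintegral_sub_right_eq_self (fun t => ‖gaussWindow t‖ₑ)]
      _ < ∞ := by
          rw [lintegral_mul_const' _ _ integrable_gaussWindow.2.ne]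
          exact ENNReal.mul_lt_top hF.2 integrable_gaussWindow.2
  refine memLp_two_of_bounded (C := ∫ z, ‖stft gaussWindow f z * (m z : ℂ)‖ * 2)
    hint.integral_prod_right fun t => ?_
  refine norm_integral_le_of_norm_le (hF.norm.mul_const 2) (.of_forall fun z => ?_)
  rw [norm_mul _ (tfShift _ _ _), norm_tfShift]
  gcongr
  exact gaussWindow_norm_le _

end LocOp

/-! ### The Bargmann transform -/

section Bargmann

/-- Covariance of the short-time Fourier transform. -/
theorem stft_tfShift (φ ψ : ℝ → ℂ) (w z : ℝ × ℝ) :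
    stft φ (tfShift w ψ) z =
      Complex.exp (2 * Real.pi * Complex.I * (w.2 - z.2) * w.1) * stft φ ψ (z - w) := by
  rw [stft, stft, ← integral_const_mul,
    ← integral_add_right_eq_self (fun t => tfShift w ψ t * (starRingEnd ℂ) (tfShift z φ t)) w.1]
  refine integral_congr_ae (.of_forall fun t => ?_)
  simp only [tfShift, map_mul, ← Complex.exp_conj, Prod.fst_sub, Prod.snd_sub, add_sub_cancel_right,
    Complex.conj_ofReal, Complex.conj_I, Complex.conj_ofNat]
  rw [show t + w.1 - z.1 = t - (z.1 - w.1) by ring]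
  have : ∀ a b c d e f : ℂ, a * b = c * d → a * e * (b * f) = c * (e * (d * f)) := by
    intro a b c d e f h
    linear_combination (e * f) * h
  refine this _ _ _ _ _ _ ?_
  rw [← Complex.exp_add, ← Complex.exp_add]
  congr 1
  push_cast
  ring

/-- The Bargmann transform, up to a constant and a chirp. -/
noncomputable def bargmann (f : ℝ → ℂ) (ζ : ℂ) : ℂ :=
  ∫ t : ℝ, f t * (((2 : ℝ) ^ (1 / 4 : ℝ) : ℝ) *
    Complex.exp (-Real.pi * t ^ 2 + 2 * Real.pi * ζ * t))

theorem stft_gaussWindow_eq_bargmann (f : ℝ → ℂ) (z : ℝ × ℝ) :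
    stft gaussWindow f z =
      Complex.exp (-Real.pi * z.1 ^ 2) * bargmann f (z.1 - z.2 * Complex.I) := by
  rw [stft, bargmann, ← integral_const_mul]
  refine integral_congr_ae (.of_forall fun t => ?_)
  simp only [tfShift, map_mul, ← Complex.exp_conj, gaussWindow,
    Complex.conj_ofReal, Complex.conj_I, Complex.conj_ofNat, Complex.ofReal_mul, Complex.ofReal_exp]
  have : ∀ a b c d e f : ℂ, a * b = c * d → f * (a * (e * b)) = c * (f * (e * d)) := by
    intro a b c d e f h
    linear_combination (e * f) * h
  refine this _ _ _ _ _ _ ?_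
  rw [← Complex.exp_add, ← Complex.exp_add]
  congr 1
  push_cast
  ring

/-- A complex Gaussian integral. What matters later is that the value never vanishes, so one may
divide by it. -/
theorem bargmann_gaussWindow (ζ : ℂ) :
    bargmann gaussWindow ζ = Complex.exp (Real.pi * ζ ^ 2 / 2) := by
  have h2 : (((2 : ℝ) ^ (1 / 4 : ℝ) : ℝ) : ℂ) * (((2 : ℝ) ^ (1 / 4 : ℝ) : ℝ) : ℂ)
      = (2 : ℂ) ^ (1 / 2 : ℂ) := by
    rw [← Complex.ofReal_mul, ← Real.rpow_add two_pos, Complex.ofReal_cpow zero_le_two]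
    norm_num
  have h1 : ∀ t : ℝ, gaussWindow t * (((2 : ℝ) ^ (1 / 4 : ℝ) : ℝ) *
      Complex.exp (-Real.pi * t ^ 2 + 2 * Real.pi * ζ * t))
      = (2 : ℂ) ^ (1 / 2 : ℂ) *
        Complex.exp ((-(2 * Real.pi) : ℂ) * t ^ 2 + (2 * Real.pi * ζ) * t + 0) := by
    intro t
    rw [gaussWindow, ← h2]
    push_cast
    rw [mul_mul_mul_comm, ← Complex.exp_add]
    congr 2
    ring
  have hpi : (Real.pi : ℂ) ≠ 0 := by exact_mod_cast Real.pi_ne_zero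
  rw [bargmann]
  simp_rw [h1]
  rw [integral_const_mul, integral_cexp_quadratic (by simp [Real.pi_pos]), neg_neg,
    show (Real.pi : ℂ) / (2 * Real.pi) = ((1 / 2 : ℝ) : ℂ) by push_cast; field_simp, ← mul_assoc,
    show (2 : ℂ) = ((2 : ℝ) : ℂ) by norm_num,
    show (1 : ℂ) / ((2 : ℝ) : ℂ) = ((1 / 2 : ℝ) : ℂ) by norm_num,
    ← Complex.ofReal_cpow zero_le_two, ← Complex.ofReal_cpow (by norm_num), ← Complex.ofReal_mul,
    ← Real.mul_rpow (by norm_num) (by norm_num)]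
  norm_num
  field_simp
  congr 1
  ring

theorem norm_stft_gaussWindow_gaussWindow (z : ℝ × ℝ) :
    ‖stft gaussWindow gaussWindow z‖ = Real.exp (-(Real.pi / 2) * sqLen z) := by
  rw [stft_gaussWindow_eq_bargmann, bargmann_gaussWindow, ← Complex.exp_add, Complex.norm_exp]
  congr 1
  simp [sqLen, sq]
  ring

end Bargmann

/-! ### Rigidity of the Gaussian via Liouville's theorem -/

section Liouville

theorem memLp_exp_neg_mul_sq {b : ℝ} (hb : 0 < b) :
    MemLp (fun t : ℝ => ((Real.exp (-b * t ^ 2) : ℝ) : ℂ)) 2 volume := by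
  refine memLp_two_of_bounded (integrable_exp_neg_mul_sq hb).ofReal (C := 1) fun t => ?_
  rw [Complex.norm_real, Real.norm_of_nonneg (by positivity), Real.exp_le_one_iff]
  nlinarith [sq_nonneg t]

/-- The extra factor `exp (2π|t|)` dominates both 1 and the factor `2πt` produced by differentiation
in `ζ`, so one bound serves the integrand and its derivative. Half of the Gaussian decay pays for
the linear terms. -/
theorem norm_cexp_bargmann_le {ζ : ℂ} {K : ℝ} (hζ : ‖ζ‖ + 1 ≤ K) (t : ℝ) :
    ‖Complex.exp (-Real.pi * t ^ 2 + 2 * Real.pi * ζ * t)‖ * Real.exp (2 * Real.pi * |t|) ≤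
      Real.exp (2 * Real.pi * K ^ 2) * Real.exp (-(Real.pi / 2) * t ^ 2) := by
  rw [Complex.norm_exp, ← Real.exp_add, ← Real.exp_add, Real.exp_le_exp]
  have h1 : (-(Real.pi : ℂ) * t ^ 2 + 2 * Real.pi * ζ * t).re
      = Real.pi * (-t ^ 2 + 2 * (ζ.re * t)) := by
    simp [sq]
    ring
  have h2 : ζ.re * t ≤ ‖ζ‖ * |t| :=
    (le_abs_self _).trans (by rw [abs_mul]; gcongr; exact Complex.abs_re_le_norm ζ)
  have h3 : ‖ζ‖ * |t| + |t| ≤ K * |t| := by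
    rw [← add_one_mul]
    gcongr
  rw [h1]
  have h4 : -t ^ 2 + 2 * (ζ.re * t) + 2 * |t| ≤ 2 * K ^ 2 + -(1 / 2) * t ^ 2 := by
    nlinarith [sq_nonneg (|t| - 2 * K), sq_abs t]
  have := mul_le_mul_of_nonneg_left h4 Real.pi_pos.le
  linarith

theorem differentiable_bargmann {f : ℝ → ℂ} (hf : MemLp f 2 volume) :
    Differentiable ℂ (bargmann f) := by
  intro ζ₀
  set c : ℂ := (((2 : ℝ) ^ (1 / 4 : ℝ) : ℝ) : ℂ) with hc
  set K : ℝ := ‖ζ₀‖ + 2 with hK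
  set bound : ℝ → ℝ := fun t =>
    ‖f t * ((Real.exp (-(Real.pi / 2) * t ^ 2) : ℝ) : ℂ)‖ *
      (‖c‖ * Real.exp (2 * Real.pi * K ^ 2)) with hbound
  have hb_int : Integrable bound volume :=
    (hf.integrable_mul_two (memLp_exp_neg_mul_sq (by positivity))).norm.mul_const _
  have key : ∀ (ζ : ℂ) (t r : ℝ), ‖ζ‖ + 1 ≤ K → r ≤ Real.exp (2 * Real.pi * |t|) →
      ‖f t‖ * (‖c‖ * ‖Complex.exp (-Real.pi * t ^ 2 + 2 * Real.pi * ζ * t)‖ * r) ≤ bound t := by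
    intro ζ t r hζ hr
    rw [hbound]
    simp only
    rw [norm_mul, Complex.norm_real (Real.exp _), Real.norm_of_nonneg (Real.exp_pos _).le]
    calc _ ≤ ‖f t‖ * (‖c‖ * (‖Complex.exp (-Real.pi * t ^ 2 + 2 * Real.pi * ζ * t)‖ *
          Real.exp (2 * Real.pi * |t|))) := by
          rw [mul_assoc]
          gcongr
      _ ≤ ‖f t‖ * (‖c‖ * (Real.exp (2 * Real.pi * K ^ 2) *
          Real.exp (-(Real.pi / 2) * t ^ 2))) := by
          exact mul_le_mul_of_nonneg_left (mul_le_mul_of_nonneg_left (norm_cexp_bargmann_le hζ t)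
            (norm_nonneg c)) (norm_nonneg _)
      _ = _ := by ring
  have hmeas : ∀ ζ : ℂ, AEStronglyMeasurable (fun t : ℝ => f t * (c *
      Complex.exp (-Real.pi * t ^ 2 + 2 * Real.pi * ζ * t))) volume := fun ζ =>
    hf.1.mul (Continuous.aestronglyMeasurable (by fun_prop))
  refine (hasDerivAt_integral_of_dominated_loc_of_deriv_le
    (F := fun ζ (t : ℝ) => f t * (c * Complex.exp (-Real.pi * t ^ 2 + 2 * Real.pi * ζ * t)))
    (F' := fun ζ (t : ℝ) => f t * (c * (Complex.exp (-Real.pi * t ^ 2 + 2 * Real.pi * ζ * t) *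
      (2 * Real.pi * t)))) (bound := bound)
    (Metric.ball_mem_nhds ζ₀ one_pos) (.of_forall hmeas) ?_ ?_ ?_ hb_int ?_).2.differentiableAt
  · refine hb_int.mono' (hmeas ζ₀) (.of_forall fun t => ?_)
    have := key ζ₀ t 1 (by rw [hK]; linarith) (Real.one_le_exp (by positivity))
    rwa [mul_one, ← norm_mul, ← norm_mul] at this
  · exact hf.1.mul (Continuous.aestronglyMeasurable (by fun_prop))
  · refine .of_forall fun t ζ hζ => ?_
    have h1 : ‖ζ‖ + 1 ≤ K := by
      rw [Metric.mem_ball, dist_eq_norm] at hζ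
      have := norm_le_norm_add_norm_sub ζ₀ ζ
      rw [norm_sub_rev] at this
      rw [hK]
      linarith [norm_sub_rev ζ ζ₀]
    have h2 : ‖(2 * Real.pi * t : ℂ)‖ ≤ Real.exp (2 * Real.pi * |t|) := by
      have : ‖(2 * Real.pi * t : ℂ)‖ = 2 * Real.pi * |t| := by
        simp [abs_of_pos Real.pi_pos]
      rw [this]
      linarith [Real.add_one_le_exp (2 * Real.pi * |t|)]
    have := key ζ t _ h1 h2
    rwa [← norm_mul, ← norm_mul, ← norm_mul, mul_assoc c] at this
  · refine .of_forall fun t ζ _ => ?_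
    have h : HasDerivAt (fun ζ : ℂ => -Real.pi * t ^ 2 + 2 * Real.pi * ζ * t)
        (2 * Real.pi * t : ℂ) ζ := by
      have := (((hasDerivAt_id ζ).const_mul (2 * Real.pi : ℂ)).mul_const (t : ℂ)).const_add
        (-Real.pi * t ^ 2 : ℂ)
      simpa using this
    exact (h.cexp.const_mul c).const_mul (f t)

/-- A square integrable function whose short-time Fourier transform is dominated by that of the
Gaussian is a multiple of the Gaussian. -/
theorem exists_ae_eq_smul_gaussWindow {f : ℝ → ℂ} (hf : MemLp f 2 volume) {K : ℝ}
    (hK : ∀ z, ‖stft gaussWindow f z‖ ≤ K * ‖stft gaussWindow gaussWindow z‖) :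
    ∃ c : ℂ, f =ᵐ[volume] c • gaussWindow := by
  -- The quotient of the Bargmann transforms of `f` and of the Gaussian.
  set g : ℂ → ℂ := fun ζ => bargmann f ζ * Complex.exp (-(Real.pi * ζ ^ 2 / 2)) with hg
  have hgd : Differentiable ℂ g := (differentiable_bargmann hf).mul (by fun_prop)
  have hgb : Bornology.IsBounded (Set.range g) := by
    refine isBounded_iff_forall_norm_le.2 ⟨K, ?_⟩
    rintro _ ⟨ζ, rfl⟩
    have h := hK (ζ.re, -ζ.im)
    have hζ : ((ζ.re : ℂ) - ((-ζ.im : ℝ) : ℂ) * Complex.I) = ζ := by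
      push_cast
      rw [neg_mul, sub_neg_eq_add, Complex.re_add_im]
    rw [stft_gaussWindow_eq_bargmann, stft_gaussWindow_eq_bargmann] at h
    simp only [hζ, norm_mul, bargmann_gaussWindow] at h
    rw [mul_left_comm] at h
    have h' := le_of_mul_le_mul_left h (norm_pos_iff.2 (Complex.exp_ne_zero _))
    rw [hg]
    simp only [norm_mul]
    rw [Complex.exp_neg, norm_inv, ← div_eq_mul_inv]
    exact (div_le_iff₀ (norm_pos_iff.2 (Complex.exp_ne_zero _))).2 h'
  refine ⟨g 0, ?_⟩
  have hst : stft gaussWindow f = g 0 • stft gaussWindow gaussWindow := by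
    ext z
    have h := hgd.apply_eq_apply_of_bounded hgb 0 (z.1 - z.2 * Complex.I)
    rw [Pi.smul_apply, smul_eq_mul, h, hg, stft_gaussWindow_eq_bargmann,
      stft_gaussWindow_eq_bargmann, bargmann_gaussWindow]
    simp only
    rw [Complex.exp_neg]
    field_simp [Complex.exp_ne_zero]
  -- The transform of `f - g 0 • gaussWindow` vanishes, so Moyal's identity forces this function to
  -- be zero almost everywhere.
  have hu : MemLp (f + (-g 0) • gaussWindow) 2 volume := hf.add (memLp_gaussWindow.const_smul _)
  have h0 := lintegral_sq_stft hu
  rw [stft_add hf (memLp_gaussWindow.const_smul _) memLp_gaussWindow, stft_smul, hst] at h0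
  simp only [neg_smul, add_neg_cancel, Pi.zero_apply, enorm_zero, ne_eq, OfNat.ofNat_ne_zero,
    not_false_eq_true, zero_pow, lintegral_zero] at h0
  have h1 := (lintegral_eq_zero_iff' ?_).1 h0.symm
  · filter_upwards [h1] with t ht
    simp only [Pi.zero_apply, pow_eq_zero_iff two_ne_zero, enorm_eq_zero] at ht
    simpa [add_neg_eq_zero] using ht
  · simpa only [neg_smul] using (hu.1.enorm.pow_const 2)

/-- For a multiple of the Gaussian as window, the localization operator is a positive multiple of
the one with Gaussian window. -/
theorem locOp_smul_gaussWindow {φ : ℝ → ℂ} {c : ℂ} (h : φ =ᵐ[volume] c • gaussWindow)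
    (m : ℝ × ℝ → ℝ) (f : ℝ → ℂ) :
    locOp m φ f = ((‖c‖ ^ 2 : ℝ) : ℂ) • locOp m gaussWindow f := by
  have hst : ∀ z, stft φ f z = (starRingEnd ℂ) c * stft gaussWindow f z := by
    intro z
    rw [stft, stft, ← integral_const_mul]
    refine integral_congr_ae ?_
    have := (measurePreserving_sub_right (volume : Measure ℝ) z.1).quasiMeasurePreserving.ae_eq_comp h
    filter_upwards [this] with t ht
    simp only [Function.comp_apply, Pi.smul_apply, smul_eq_mul] at ht
    simp only [tfShift, ht, map_mul]
    ring
  ext t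
  rw [Pi.smul_apply, locOp, locOp, smul_eq_mul, ← integral_const_mul]
  refine integral_congr_ae ?_
  -- For fixed `t` the almost-everywhere identity is pulled back along `x ↦ t - x` and then along
  -- the first projection, to hold for almost every `z` of the plane.
  have h1 := (Measure.measurePreserving_sub_left (volume : Measure ℝ)
    t).quasiMeasurePreserving.ae_eq_comp h
  have h2 := (Measure.quasiMeasurePreserving_fst (μ := (volume : Measure ℝ))
    (ν := (volume : Measure ℝ))).ae_eq_comp h1
  filter_upwards [h2] with z hz
  simp only [Function.comp_apply, Pi.smul_apply, smul_eq_mul] at hz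
  simp only [tfShift, hz, hst]
  have : ((‖c‖ ^ 2 : ℝ) : ℂ) = (starRingEnd ℂ) c * c := by
    rw [Complex.conj_mul']
    push_cast
    rfl
  rw [this]
  ring

end Liouville

/-! ### Sums over relatively separated sets -/

section Separated

theorem RelativelySeparated.countable {Γ : Set (ℝ × ℝ)} (h : RelativelySeparated Γ) :
    Γ.Countable := by
  obtain ⟨N, hN⟩ := h
  have hcover : Γ ⊆ ⋃ k : ℤ × ℤ, Γ ∩ Set.Icc ((k.1 : ℝ), (k.2 : ℝ)) (((k.1 : ℝ), (k.2 : ℝ)) + (1, 1)) := by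
    intro z hz
    refine Set.mem_iUnion.2 ⟨(⌊z.1⌋, ⌊z.2⌋), hz, ⟨Int.floor_le _, Int.floor_le _⟩,
      ⟨(Int.lt_floor_add_one _).le, (Int.lt_floor_add_one _).le⟩⟩
  refine Set.Countable.mono hcover (Set.countable_iUnion fun k => ?_)
  exact (Set.finite_of_encard_le_coe (hN _)).countable

/-- Summation over the translates of a relatively separated set is dominated by integration. -/
theorem tsum_sub_le_lintegral {Γ : Set (ℝ × ℝ)} (hΓ : Γ.Countable) {N : ℕ}
    (hN : ∀ z : ℝ × ℝ, (Γ ∩ Set.Icc z (z + (1, 1))).encard ≤ N) {p q : ℝ × ℝ → ℝ≥0∞}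
    (hq : Measurable q) (h : ∀ v u, u ∈ Set.Icc (0 : ℝ × ℝ) (1, 1) → p v ≤ q (v + u))
    (z : ℝ × ℝ) : ∑' γ : Γ, p (z - γ) ≤ N * ∫⁻ y, q y := by
  have := hΓ.to_subtype
  set S : Set (ℝ × ℝ) := Set.Icc 0 (1, 1) with hS
  have hSm : MeasurableSet S := measurableSet_Icc
  have hvol : volume S = 1 := by
    rw [hS, show Set.Icc (0 : ℝ × ℝ) (1, 1) = Set.Icc (0 : ℝ) 1 ×ˢ Set.Icc (0 : ℝ) 1 from
      Set.Icc_prod_eq _ _, Measure.volume_eq_prod, Measure.prod_prod]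
    simp
  -- Average the hypothesis over the unit square, which has volume 1, and move the integration
  -- variable to `y = z - γ + u`.
  have h1 : ∀ γ : Γ, p (z - γ) ≤ ∫⁻ y, S.indicator 1 (y - (z - γ)) * q y := by
    intro γ
    calc p (z - γ) = ∫⁻ u in S, p (z - γ) := by rw [setLIntegral_const, hvol, mul_one]
      _ ≤ ∫⁻ u in S, q (z - γ + u) := setLIntegral_mono' hSm fun u hu => h _ _ hu
      _ = ∫⁻ u, S.indicator 1 u * q (z - γ + u) := by
          rw [← lintegral_indicator hSm]
          refine lintegral_congr fun u => ?_
          by_cases hu : u ∈ S <;> simp [hu]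
      _ = ∫⁻ y, S.indicator 1 (y - (z - γ)) * q (z - γ + (y - (z - γ))) :=
          (lintegral_sub_right_eq_self (fun u => S.indicator 1 u * q (z - γ + u)) _).symm
      _ = _ := by simp only [add_sub_cancel]
  calc ∑' γ : Γ, p (z - γ) ≤ ∑' γ : Γ, ∫⁻ y, S.indicator 1 (y - (z - γ)) * q y :=
        ENNReal.tsum_le_tsum h1
    _ = ∫⁻ y, ∑' γ : Γ, S.indicator 1 (y - (z - γ)) * q y := by
        refine (lintegral_tsum fun γ => Measurable.aemeasurable ?_).symm
        exact ((measurable_one.indicator hSm).comp (by fun_prop)).mul hq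
    _ ≤ ∫⁻ y, N * q y := by
        refine lintegral_mono fun y => ?_
        simp only
        rw [ENNReal.tsum_mul_right]
        gcongr
        -- For fixed `y`, the sum of indicators counts the points of `Γ` in the unit square with
        -- lower corner `z - y`.
        have h2 : ∀ γ : Γ, S.indicator (1 : ℝ × ℝ → ℝ≥0∞) (y - (z - γ))
            = (Set.Icc (z - y) (z - y + (1, 1))).indicator 1 (γ : ℝ × ℝ) := by
          intro γ
          have : y - (z - γ) ∈ S ↔ (γ : ℝ × ℝ) ∈ Set.Icc (z - y) (z - y + (1, 1)) := by
            rw [hS, Set.mem_Icc, Set.mem_Icc, show y - (z - (γ : ℝ × ℝ)) = γ - (z - y) by abel,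
              sub_nonneg (a := (γ : ℝ × ℝ)), sub_le_iff_le_add' (a := (γ : ℝ × ℝ))]
          by_cases hγ : (γ : ℝ × ℝ) ∈ Set.Icc (z - y) (z - y + (1, 1))
          · rw [Set.indicator_of_mem hγ, Set.indicator_of_mem (this.2 hγ)]
            rfl
          · rw [Set.indicator_of_notMem hγ, Set.indicator_of_notMem (mt this.1 hγ)]
        simp_rw [h2]
        rw [tsum_subtype Γ (fun x => (Set.Icc (z - y) (z - y + (1, 1))).indicator
          (1 : ℝ × ℝ → ℝ≥0∞) x), Set.indicator_indicator, ← tsum_subtype]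
        simp only [Pi.one_apply, ENNReal.tsum_set_one]
        exact_mod_cast hN (z - y)
    _ = _ := lintegral_const_mul _ hq

theorem sqLen_nonneg (z : ℝ × ℝ) : 0 ≤ sqLen z := by
  unfold sqLen
  positivity

theorem continuous_sqLen : Continuous sqLen := by
  unfold sqLen
  fun_prop

theorem norm_sq_le_sqLen (z : ℝ × ℝ) : ‖z‖ ^ 2 ≤ sqLen z := by
  rw [Prod.norm_def, sqLen]
  rcases max_cases ‖z.1‖ ‖z.2‖ with h | h <;> rw [h.1, Real.norm_eq_abs, sq_abs] <;>
    nlinarith [sq_nonneg z.1, sq_nonneg z.2]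

theorem sqLen_le_of_norm_le {z : ℝ × ℝ} {R : ℝ} (h : ‖z‖ ≤ R) : sqLen z ≤ 2 * R ^ 2 := by
  have h1 := (norm_fst_le z).trans h
  have h2 := (norm_snd_le z).trans h
  rw [Real.norm_eq_abs] at h1 h2
  have h3 := sq_le_sq' (abs_le.1 h1).1 (abs_le.1 h1).2
  have h4 := sq_le_sq' (abs_le.1 h2).1 (abs_le.1 h2).2
  rw [sqLen]
  linarith

theorem continuous_one_add_sqLen_rpow (s : ℝ) :
    Continuous fun z : ℝ × ℝ => (1 + sqLen z) ^ (-s) :=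
  (continuous_const.add continuous_sqLen).rpow_const fun z =>
    Or.inl (add_pos_of_pos_of_nonneg one_pos (sqLen_nonneg z)).ne'

theorem integrable_one_add_sqLen_rpow {s : ℝ} (hs : 1 < s) :
    Integrable fun z : ℝ × ℝ => (1 + sqLen z) ^ (-s) := by
  have h : Integrable (fun z : ℝ × ℝ => (1 + ‖z‖ ^ 2) ^ (-(2 * s) / 2)) volume := by
    refine integrable_rpow_neg_one_add_norm_sq ?_
    simp
    linarith
  refine h.mono' (continuous_one_add_sqLen_rpow s).aestronglyMeasurable (.of_forall fun z => ?_)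
  have h0 := sqLen_nonneg z
  rw [Real.norm_of_nonneg (by positivity), show -(2 * s) / 2 = -s by ring]
  exact Real.rpow_le_rpow_of_nonpos (by positivity) (by linarith [norm_sq_le_sqLen z]) (by linarith)

/-- The constant 5 comes from `|v + u|² ≤ 2|v|² + 2|u|²` and `|u|² ≤ 2`, so that `1 + |v + u|² ≤ 5 +
2|v|²`. -/
theorem one_add_sqLen_rpow_le {s : ℝ} (hs : 0 ≤ s) (v : ℝ × ℝ) {u : ℝ × ℝ}
    (hu : u ∈ Set.Icc (0 : ℝ × ℝ) (1, 1)) :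
    (1 + sqLen v) ^ (-s) ≤ 5 ^ s * (1 + sqLen (v + u)) ^ (-s) := by
  obtain ⟨⟨h1, h2⟩, h3, h4⟩ := hu
  simp only [Prod.fst_zero, Prod.snd_zero] at h1 h2 h3 h4
  have hv := sqLen_nonneg v
  have hvu := sqLen_nonneg (v + u)
  have key : (1 + sqLen (v + u)) / 5 ≤ 1 + sqLen v := by
    simp only [sqLen, Prod.fst_add, Prod.snd_add]
    nlinarith [sq_nonneg (v.1 - u.1), sq_nonneg (v.2 - u.2), sq_nonneg v.1, sq_nonneg v.2,
      mul_nonneg h1 (sub_nonneg.2 h3), mul_nonneg h2 (sub_nonneg.2 h4)]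
  calc _ ≤ ((1 + sqLen (v + u)) / 5) ^ (-s) :=
        Real.rpow_le_rpow_of_nonpos (by positivity) key (by linarith)
    _ = _ := by
        rw [Real.div_rpow (by positivity) (by norm_num), Real.rpow_neg (x := 5) (by norm_num),
          div_inv_eq_mul, mul_comm]

theorem tendsto_lintegral_indicator_lt_norm {f : ℝ × ℝ → ℝ≥0∞} (hf : Measurable f)
    (hfin : ∫⁻ z, f z ≠ ∞) :
    Tendsto (fun n : ℕ => ∫⁻ z, {z : ℝ × ℝ | (n : ℝ) < ‖z‖}.indicator f z) atTop (𝓝 0) := by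
  have h := tendsto_lintegral_of_dominated_convergence (μ := volume)
    (F := fun (n : ℕ) z => {z : ℝ × ℝ | (n : ℝ) < ‖z‖}.indicator f z) (f := fun _ => 0) f
    (fun n => hf.indicator (measurableSet_lt measurable_const measurable_norm))
    (fun n => .of_forall fun z => Set.indicator_le_self _ _ _) hfin (.of_forall fun z => ?_)
  · simpa using h
  · obtain ⟨m, hm⟩ := exists_nat_ge ‖z‖
    refine tendsto_const_nhds.congr' ?_
    filter_upwards [eventually_ge_atTop m] with n hn
    have : (m : ℝ) ≤ n := by exact_mod_cast hn
    rw [Set.indicator_of_notMem]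
    simp only [Set.mem_ofPred_eq, not_lt]
    linarith

/-- The profile `C (1 + |z|²)^{-s}` as an extended nonnegative function. -/
noncomputable def decayProfile (C s : ℝ) (z : ℝ × ℝ) : ℝ≥0∞ :=
  ENNReal.ofReal (C * (1 + sqLen z) ^ (-s))

theorem measurable_decayProfile (C s : ℝ) : Measurable (decayProfile C s) :=
  ((continuous_one_add_sqLen_rpow s).measurable.const_mul C).ennreal_ofReal

theorem lintegral_decayProfile_ne_top (C : ℝ) {s : ℝ} (hs : 1 < s) :
    ∫⁻ z, decayProfile C s z ≠ ∞ :=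
  ((integrable_one_add_sqLen_rpow hs).const_mul C).lintegral_lt_top.ne

theorem decayProfile_le {C s : ℝ} (hC : 0 ≤ C) (hs : 0 ≤ s) (v : ℝ × ℝ) {u : ℝ × ℝ}
    (hu : u ∈ Set.Icc (0 : ℝ × ℝ) (1, 1)) :
    decayProfile C s v ≤ decayProfile (C * 5 ^ s) s (v + u) := by
  refine ENNReal.ofReal_le_ofReal ?_
  rw [mul_assoc]
  exact mul_le_mul_of_nonneg_left (one_add_sqLen_rpow_le hs v hu) hC

theorem exists_tsum_decayProfile_le {Γ : Set (ℝ × ℝ)} (hΓ : RelativelySeparated Γ) {C s : ℝ}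
    (hC : 0 ≤ C) (hs : 1 < s) :
    ∃ S : ℝ≥0∞, S ≠ ∞ ∧ ∀ z : ℝ × ℝ, ∑' γ : Γ, decayProfile C s (z - γ) ≤ S := by
  have hc := hΓ.countable
  obtain ⟨N, hN⟩ := hΓ
  exact ⟨_, ENNReal.mul_ne_top (ENNReal.natCast_ne_top N)
    (lintegral_decayProfile_ne_top (C * 5 ^ s) hs),
    tsum_sub_le_lintegral hc hN (measurable_decayProfile _ _)
      fun v u hu => decayProfile_le hC (by linarith) v hu⟩

theorem exists_tsum_indicator_decayProfile_le {Γ : Set (ℝ × ℝ)} (hΓ : RelativelySeparated Γ)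
    {C s : ℝ} (hC : 0 ≤ C) (hs : 1 < s) {ε : ℝ≥0∞} (hε : 0 < ε) :
    ∀ᶠ n : ℕ in atTop, ∀ z : ℝ × ℝ,
      ∑' γ : Γ, {y : ℝ × ℝ | (n : ℝ) < ‖y‖}.indicator (decayProfile C s) (z - γ) ≤ ε := by
  have hc := hΓ.countable
  obtain ⟨N, hN⟩ := hΓ
  have hlim := ENNReal.Tendsto.const_mul (a := (N : ℝ≥0∞)) (tendsto_lintegral_indicator_lt_norm
    (measurable_decayProfile (C * 5 ^ s) s) (lintegral_decayProfile_ne_top (C * 5 ^ s) hs))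
    (.inr (ENNReal.natCast_ne_top N))
  rw [mul_zero] at hlim
  obtain ⟨m, hm⟩ := eventually_atTop.1 (hlim.eventually_le_const hε)
  refine eventually_atTop.2 ⟨m + 1, fun k hk z => ?_⟩
  -- Moving by a point of the unit square changes the norm by at most 1, so the cutoff `n + 1` in
  -- the sum becomes `n` in the integral.
  obtain ⟨n, rfl⟩ : ∃ n, k = n + 1 := ⟨k - 1, by omega⟩
  have hn := hm n (by omega)
  refine le_trans (tsum_sub_le_lintegral hc hN ((measurable_decayProfile (C * 5 ^ s) s).indicator
    (measurableSet_lt measurable_const measurable_norm)) ?_ z) hn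
  intro v u hu
  by_cases hv : v ∈ {y : ℝ × ℝ | ((n + 1 : ℕ) : ℝ) < ‖y‖}
  · have hu1 : ‖u‖ ≤ 1 := by
      obtain ⟨⟨h1, h2⟩, h3, h4⟩ := hu
      rw [Prod.norm_def, Real.norm_of_nonneg h1, Real.norm_of_nonneg h2]
      exact max_le h3 h4
    have hvu : v + u ∈ {y : ℝ × ℝ | (n : ℝ) < ‖y‖} := by
      have := norm_sub_le (v + u) u
      rw [add_sub_cancel_right] at this
      simp only [Set.mem_ofPred_eq, Nat.cast_add, Nat.cast_one] at hv ⊢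
      linarith
    rw [Set.indicator_of_mem hv, Set.indicator_of_mem hvu]
    exact decayProfile_le hC (by linarith) v hu
  · rw [Set.indicator_of_notMem hv]
    exact zero_le

/-- Bounded overlap of balls of radius `R`: their indicator lies below a decay profile whose
constant `(1 + 2R²)²` makes it at least 1 on the ball. -/
theorem exists_tsum_indicator_one_le {Γ : Set (ℝ × ℝ)} (hΓ : RelativelySeparated Γ) (R : ℝ) :
    ∃ M : ℝ≥0∞, M ≠ ∞ ∧ ∀ w : ℝ × ℝ,
      ∑' γ : Γ, {y : ℝ × ℝ | ‖y‖ ≤ R}.indicator (1 : ℝ × ℝ → ℝ≥0∞) (w - γ) ≤ M := by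
  have hR : 0 < 1 + 2 * R ^ 2 := by positivity
  obtain ⟨S, hS, h⟩ := exists_tsum_decayProfile_le hΓ (C := (1 + 2 * R ^ 2) ^ (2 : ℝ)) (s := 2)
    (by positivity) (by norm_num)
  refine ⟨S, hS, fun w => (ENNReal.tsum_le_tsum fun γ => ?_).trans (h w)⟩
  refine Set.indicator_le (fun y hy => ?_) _
  have h0 := sqLen_nonneg y
  have h1 := sqLen_le_of_norm_le hy
  rw [Pi.one_apply, decayProfile, ENNReal.one_le_ofReal, Real.rpow_neg (by positivity),
    ← div_eq_mul_inv, one_le_div (by positivity)]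
  gcongr

end Separated

/-! ### Upper bound, coercivity and Schur's test -/

section Estimates

theorem ENNReal.mul_le_inv_mul_sq_add_mul_sq (a b : ℝ≥0∞) {δ : ℝ≥0∞} (h0 : δ ≠ 0) (ht : δ ≠ ∞) :
    a * b ≤ δ⁻¹ * a ^ 2 + δ * b ^ 2 := by
  rcases le_total a (δ * b) with h | h
  · calc a * b ≤ δ * b * b := by gcongr
      _ = δ * b ^ 2 := by ring
      _ ≤ _ := le_add_self
  · have h' : b ≤ δ⁻¹ * a := by
      rw [← ENNReal.div_eq_inv_mul, ENNReal.le_div_iff_mul_le (.inl h0) (.inl ht), mul_comm]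
      exact h
    calc a * b ≤ a * (δ⁻¹ * a) := by gcongr
      _ = δ⁻¹ * a ^ 2 := by ring
      _ ≤ _ := le_self_add

theorem enorm_complex_ofReal (r : ℝ) : ‖(r : ℂ)‖ₑ = ‖r‖ₑ := by
  rw [← ofReal_norm, Complex.norm_real, ofReal_norm]

theorem enorm_integral_mul_conj_self {α : Type*} [MeasurableSpace α] {μ : Measure α} {f : α → ℂ}
    (hf : MemLp f 2 μ) : ‖∫ x, f x * (starRingEnd ℂ) (f x) ∂μ‖ₑ = ∫⁻ x, ‖f x‖ₑ ^ 2 ∂μ := by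
  have h1 : ∀ x, f x * (starRingEnd ℂ) (f x) = ((‖f x‖ ^ 2 : ℝ) : ℂ) := fun x => by
    rw [Complex.mul_conj']
    push_cast
    rfl
  have h2 : Integrable (fun x => ‖f x‖ ^ 2) μ := (memLp_two_iff_integrable_sq_norm hf.1).1 hf
  simp_rw [h1]
  rw [integral_complex_ofReal, ← ofReal_norm, Complex.norm_real,
    Real.norm_of_nonneg (integral_nonneg fun x => by positivity),
    ofReal_integral_eq_lintegral_ofReal h2 (.of_forall fun x => by positivity)]
  refine lintegral_congr fun x => ?_
  rw [ENNReal.ofReal_pow (norm_nonneg _), ofReal_norm]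

/-- Test the weak form against `h = H f` itself. Young's inequality with weight `1/2` leaves half of
`‖h‖²` on the right, which is absorbed because it is known to be finite. -/
theorem lintegral_sq_locOp_le {f : ℝ → ℂ} (hf : MemLp f 2 volume) {m : ℝ × ℝ → ℝ}
    (hm : Integrable m volume) :
    ∫⁻ t, ‖locOp m gaussWindow f t‖ₑ ^ 2 ≤ 4 * ∫⁻ z, ‖stft gaussWindow f z‖ₑ ^ 2 * ‖m z‖ₑ ^ 2 := by
  set h := locOp m gaussWindow f with hh
  have hL : MemLp h 2 volume := memLp_locOp hf hm
  set X := ∫⁻ z, ‖stft gaussWindow f z‖ₑ ^ 2 * ‖m z‖ₑ ^ 2 with hX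
  set Y := ∫⁻ t, ‖h t‖ₑ ^ 2 with hY
  have hY' : ∫⁻ z, ‖stft gaussWindow h z‖ₑ ^ 2 = Y := lintegral_sq_stft hL
  have hYfin : Y ≠ ∞ := hL.lintegral_sq_lt_top.ne
  have h1 : Y ≤ 2 * X + Y / 2 := by
    calc Y = ‖∫ t, h t * (starRingEnd ℂ) (h t)‖ₑ := (enorm_integral_mul_conj_self hL).symm
      _ = ‖∫ z, stft gaussWindow f z * (m z : ℂ) * (starRingEnd ℂ) (stft gaussWindow h z)‖ₑ := by
          rw [← integral_locOp_mul_conj hf hL hm]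
      _ ≤ ∫⁻ z, ‖stft gaussWindow f z‖ₑ * ‖m z‖ₑ * ‖stft gaussWindow h z‖ₑ := by
          refine (enorm_integral_le_lintegral_enorm _).trans_eq (lintegral_congr fun z => ?_)
          rw [enorm_mul, enorm_mul, RCLike.enorm_conj, enorm_complex_ofReal]
      _ ≤ ∫⁻ z, (2 * (‖stft gaussWindow f z‖ₑ ^ 2 * ‖m z‖ₑ ^ 2) +
            2⁻¹ * ‖stft gaussWindow h z‖ₑ ^ 2) := by
          refine lintegral_mono fun z => ?_
          have := ENNReal.mul_le_inv_mul_sq_add_mul_sq (‖stft gaussWindow f z‖ₑ * ‖m z‖ₑ)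
            ‖stft gaussWindow h z‖ₑ (δ := 2⁻¹) (by simp) (by simp)
          rwa [inv_inv, mul_pow] at this
      _ = _ := by
          rw [lintegral_add_right' _ (((memLp_stft hL).1.enorm.pow_const 2).const_mul _),
            lintegral_const_mul' _ _ (by simp), lintegral_const_mul' _ _ (by simp), hY', ← hX,
            ENNReal.div_eq_inv_mul]
  have h2 : Y / 2 ≤ 2 * X := by
    refine (ENNReal.add_le_add_iff_right (a := Y / 2) (ENNReal.div_ne_top hYfin (by simp))).1 ?_
    rwa [ENNReal.add_halves]
  calc Y = 2 * (Y / 2) := (ENNReal.mul_div_cancel (by simp) (by simp)).symm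
    _ ≤ 2 * (2 * X) := by gcongr
    _ = 4 * X := by ring

/-- Upper frame bound for localization operators with Gaussian window. -/
theorem tsum_lintegral_sq_locOp_le {Γ : Set (ℝ × ℝ)} [Countable Γ] {η : Γ → ℝ × ℝ → ℝ}
    (hη : ∀ γ, Integrable (η γ) volume) {S : ℝ≥0∞} (hS : ∀ z, ∑' γ, ‖η γ z‖ₑ ≤ S) {f : ℝ → ℂ}
    (hf : MemLp f 2 volume) :
    ∑' γ, ∫⁻ t, ‖locOp (η γ) gaussWindow f t‖ₑ ^ 2 ≤ 4 * S ^ 2 * ∫⁻ t, ‖f t‖ₑ ^ 2 := by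
  have hF := (memLp_stft hf).1.enorm.pow_const 2
  calc _ ≤ ∑' γ, 4 * ∫⁻ z, ‖stft gaussWindow f z‖ₑ ^ 2 * ‖η γ z‖ₑ ^ 2 :=
        ENNReal.tsum_le_tsum fun γ => lintegral_sq_locOp_le hf (hη γ)
    _ = 4 * ∫⁻ z, ∑' γ, ‖stft gaussWindow f z‖ₑ ^ 2 * ‖η γ z‖ₑ ^ 2 := by
        rw [ENNReal.tsum_mul_left]
        congr 1
        exact (lintegral_tsum fun γ => hF.mul ((hη γ).1.enorm.pow_const 2)).symm
    _ ≤ 4 * ∫⁻ z, ‖stft gaussWindow f z‖ₑ ^ 2 * S ^ 2 := by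
        gcongr with z
        rw [ENNReal.tsum_mul_left]
        gcongr
        calc ∑' γ, ‖η γ z‖ₑ ^ 2 ≤ ∑' γ, S * ‖η γ z‖ₑ := by
              refine ENNReal.tsum_le_tsum fun γ => ?_
              rw [sq]
              gcongr
              exact (ENNReal.le_tsum γ).trans (hS z)
          _ ≤ S ^ 2 := by
              rw [ENNReal.tsum_mul_left, sq]
              gcongr
              exact hS z
    _ = _ := by
        rw [lintegral_mul_const'' _ hF, lintegral_sq_stft hf]
        ring

/-- The quadratic forms of the localization operators add up to a coercive form. -/
theorem mul_le_tsum_enorm_integral_locOp {Γ : Set (ℝ × ℝ)} [Countable Γ] {η : Γ → ℝ × ℝ → ℝ}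
    (hη : ∀ γ, Integrable (η γ) volume) {S : ℝ≥0∞} (hSfin : S ≠ ∞)
    (hS : ∀ z, ∑' γ, ‖η γ z‖ₑ ≤ S) {a : ℝ} (ha : 0 < a) (hsum : ∀ z, a ≤ ∑' γ, η γ z)
    {f : ℝ → ℂ} (hf : MemLp f 2 volume) :
    ENNReal.ofReal a * ∫⁻ t, ‖f t‖ₑ ^ 2 ≤
      ∑' γ, ‖∫ t, locOp (η γ) gaussWindow f t * (starRingEnd ℂ) (f t)‖ₑ := by
  set F := stft gaussWindow f with hF
  have hFL : MemLp F 2 volume := memLp_stft hf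
  have hF2 : Integrable (fun z => ‖F z‖ ^ 2) volume :=
    (memLp_two_iff_integrable_sq_norm hFL.1).1 hFL
  have hFe : ∀ z, ‖(‖F z‖ ^ 2 : ℝ)‖ₑ = ‖F z‖ₑ ^ 2 := fun z => by
    rw [enorm_pow, enorm_norm]
  have hI : ∀ γ, ‖∫ t, locOp (η γ) gaussWindow f t * (starRingEnd ℂ) (f t)‖ₑ
      = ‖∫ z, η γ z * ‖F z‖ ^ 2‖ₑ := by
    intro γ
    rw [integral_locOp_mul_conj hf hf (hη γ)]
    have : ∀ z, F z * (η γ z : ℂ) * (starRingEnd ℂ) (F z) = ((η γ z * ‖F z‖ ^ 2 : ℝ) : ℂ) := by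
      intro z
      rw [mul_right_comm, Complex.mul_conj', mul_comm]
      push_cast
      rfl
    simp_rw [← hF, this]
    rw [integral_complex_ofReal, enorm_complex_ofReal]
  have hmeas : ∀ γ, AEStronglyMeasurable (fun z => η γ z * ‖F z‖ ^ 2) volume := fun γ =>
    (hη γ).1.mul hF2.1
  have hsumfin : ∫⁻ z, ∑' γ, ‖η γ z * ‖F z‖ ^ 2‖ₑ < ∞ := by
    simp_rw [enorm_mul, hFe, ENNReal.tsum_mul_right]
    calc _ ≤ ∫⁻ z, S * ‖F z‖ₑ ^ 2 := lintegral_mono fun z => by gcongr; exact hS z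
      _ < ∞ := by
        rw [lintegral_const_mul' _ _ hSfin]
        exact ENNReal.mul_lt_top hSfin.lt_top hFL.lintegral_sq_lt_top
  have hHint : Integrable (fun z => ∑' γ, η γ z * ‖F z‖ ^ 2) volume := by
    refine ⟨(AEMeasurable.tsum fun γ => (hmeas γ).aemeasurable).aestronglyMeasurable, ?_⟩
    exact (lintegral_mono fun z => enorm_tsum_le_tsum_enorm).trans_lt hsumfin
  have hle : a * ∫ z, ‖F z‖ ^ 2 ≤ ∑' γ, ∫ z, η γ z * ‖F z‖ ^ 2 := by
    rw [← integral_tsum hmeas (by rw [← lintegral_tsum fun γ => (hmeas γ).enorm]; exact hsumfin.ne),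
      ← integral_const_mul]
    refine integral_mono (hF2.const_mul a) hHint fun z => ?_
    simp only
    rw [tsum_mul_right]
    gcongr
    exact hsum z
  have hE : ∫⁻ t, ‖f t‖ₑ ^ 2 = ENNReal.ofReal (∫ z, ‖F z‖ ^ 2) := by
    rw [ofReal_integral_eq_lintegral_ofReal hF2 (.of_forall fun z => by positivity),
      ← lintegral_sq_stft hf]
    refine lintegral_congr fun z => ?_
    rw [ENNReal.ofReal_pow (norm_nonneg _), ofReal_norm]
  simp_rw [hI]
  rw [hE, ← ENNReal.ofReal_mul ha.le]
  calc _ ≤ ENNReal.ofReal (∑' γ, ∫ z, η γ z * ‖F z‖ ^ 2) := ENNReal.ofReal_le_ofReal hle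
    _ ≤ ‖∑' γ, ∫ z, η γ z * ‖F z‖ ^ 2‖ₑ := by
        rw [← ofReal_norm]
        exact ENNReal.ofReal_le_ofReal (Real.le_norm_self _)
    _ ≤ _ := enorm_tsum_le_tsum_enorm

/-- The transform at `w` is the weak form tested against the shifted Gaussian, and covariance turns
its transform into a translate up to a phase. -/
theorem enorm_stft_locOp_le {f : ℝ → ℂ} (hf : MemLp f 2 volume) {m : ℝ × ℝ → ℝ}
    (hm : Integrable m volume) (w : ℝ × ℝ) :
    ‖stft gaussWindow (locOp m gaussWindow f) w‖ₑ ≤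
      ∫⁻ z, ‖stft gaussWindow f z‖ₑ * ‖m z‖ₑ * ‖stft gaussWindow gaussWindow (z - w)‖ₑ := by
  rw [stft, integral_locOp_mul_conj hf (memLp_tfShift w memLp_gaussWindow) hm]
  refine (enorm_integral_le_lintegral_enorm _).trans_eq (lintegral_congr fun z => ?_)
  rw [enorm_mul, enorm_mul, RCLike.enorm_conj, enorm_complex_ofReal, stft_tfShift, enorm_mul,
    show 2 * (Real.pi : ℂ) * Complex.I * (w.2 - z.2) * w.1
      = ((2 * Real.pi * (w.2 - z.2) * w.1 : ℝ) : ℂ) * Complex.I by push_cast; ring,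
    ← ofReal_norm (Complex.exp _), Complex.norm_exp_ofReal_mul_I, ENNReal.ofReal_one, one_mul]

/-- Schur's test for a convolution kernel. -/
theorem lintegral_lintegral_mul_mul_sub_le {u k : ℝ × ℝ → ℝ≥0∞} (hu : AEMeasurable u volume)
    (hk : Measurable k) :
    ∫⁻ w, ∫⁻ z, u w * u z * k (z - w) ≤ 2 * (∫⁻ z, u z ^ 2) * ∫⁻ y, k y := by
  have hm1 : AEMeasurable (fun p : (ℝ × ℝ) × (ℝ × ℝ) => u p.1 ^ 2 * k (p.2 - p.1))
      (volume.prod volume) :=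
    (hu.comp_fst.pow_const 2).mul (hk.comp (by fun_prop)).aemeasurable
  have hm2 : AEMeasurable (fun p : (ℝ × ℝ) × (ℝ × ℝ) => u p.2 ^ 2 * k (p.2 - p.1))
      (volume.prod volume) :=
    (hu.comp_snd.pow_const 2).mul (hk.comp (by fun_prop)).aemeasurable
  have hkl : ∀ w, Measurable fun z => k (z - w) := fun w => hk.comp (measurable_sub_const _)
  have hkr : ∀ z, Measurable fun w => k (z - w) := fun z => hk.comp (measurable_const_sub _)
  calc _ ≤ ∫⁻ w, ∫⁻ z, (u w ^ 2 * k (z - w) + u z ^ 2 * k (z - w)) := by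
        refine lintegral_mono fun w => lintegral_mono fun z => ?_
        simp only
        rw [← add_mul]
        gcongr
        exact ENNReal.mul_le_sq_add_sq _ _
    _ = (∫⁻ w, ∫⁻ z, u w ^ 2 * k (z - w)) + ∫⁻ z, ∫⁻ w, u z ^ 2 * k (z - w) := by
        rw [← lintegral_lintegral_swap (f := fun w z => u z ^ 2 * k (z - w)) hm2,
          ← lintegral_add_left' hm1.lintegral_prod_right']
        refine lintegral_congr fun w => ?_
        exact lintegral_add_left' ((hkl w).aemeasurable.const_mul _) _
    _ = (∫⁻ w, u w ^ 2 * ∫⁻ y, k y) + ∫⁻ z, u z ^ 2 * ∫⁻ y, k y := by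
        congr 1
        · refine lintegral_congr fun w => ?_
          rw [lintegral_const_mul _ (hkl w),
            lintegral_sub_right_eq_self k]
        · refine lintegral_congr fun z => ?_
          rw [lintegral_const_mul _ (hkr z),
            lintegral_sub_left_eq_self k]
    _ = _ := by
        rw [lintegral_mul_const'' _ (hu.pow_const 2)]
        ring

end Estimates

/-! ### Lower bound for the Gaussian window -/

section LowerBound

theorem exp_neg_mul_sqLen (z : ℝ × ℝ) : Real.exp (-(Real.pi / 2) * sqLen z)
    = Real.exp (-(Real.pi / 2) * z.1 ^ 2) * Real.exp (-(Real.pi / 2) * z.2 ^ 2) := by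
  rw [← Real.exp_add, sqLen]
  ring_nf

theorem integrable_norm_stft_gaussWindow :
    Integrable fun z => ‖stft gaussWindow gaussWindow z‖ := by
  simp_rw [norm_stft_gaussWindow_gaussWindow, exp_neg_mul_sqLen]
  exact (integrable_exp_neg_mul_sq (by positivity)).mul_prod
    (integrable_exp_neg_mul_sq (by positivity))

/-- Each one-dimensional factor integrates to `√2`. This value is what turns the assumption on `C₀`
into `C₀ < 1`. -/
theorem integral_norm_stft_gaussWindow : ∫ z, ‖stft gaussWindow gaussWindow z‖ = 2 := by
  simp_rw [norm_stft_gaussWindow_gaussWindow, exp_neg_mul_sqLen]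
  rw [Measure.volume_eq_prod, integral_prod_mul (fun x => Real.exp (-(Real.pi / 2) * x ^ 2))
    (fun x => Real.exp (-(Real.pi / 2) * x ^ 2)), integral_gaussian,
    Real.mul_self_sqrt (by positivity)]
  field_simp

theorem enorm_stft_gaussWindow_gaussWindow (z : ℝ × ℝ) :
    ‖stft gaussWindow gaussWindow z‖ₑ = ENNReal.ofReal (Real.exp (-(Real.pi / 2) * sqLen z)) := by
  rw [← ofReal_norm, norm_stft_gaussWindow_gaussWindow]

theorem measurable_enorm_stft_gaussWindow :
    Measurable fun z => ‖stft gaussWindow gaussWindow z‖ₑ := by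
  simp_rw [enorm_stft_gaussWindow_gaussWindow]
  have := continuous_sqLen.measurable
  fun_prop

/-- Splitting of the quadratic form of a localization operator into a part near `γ` and a part
far from `γ`. -/
theorem enorm_integral_locOp_mul_conj_le {f : ℝ → ℂ} (hf : MemLp f 2 volume) {m : ℝ × ℝ → ℝ}
    (hm : Integrable m volume) {q : ℝ × ℝ → ℝ≥0∞} (hq : ∀ z, ‖m z‖ₑ ≤ q z) {δ : ℝ≥0∞}
    (hδ : δ ≠ 0) (hδ' : δ ≠ ∞) {s : Set (ℝ × ℝ)} (hs : MeasurableSet s) :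
    ‖∫ t, locOp m gaussWindow f t * (starRingEnd ℂ) (f t)‖ₑ ≤
      δ⁻¹ * (∫⁻ t, ‖locOp m gaussWindow f t‖ₑ ^ 2) +
      δ * (∫⁻ w, s.indicator 1 w * ‖stft gaussWindow f w‖ₑ ^ 2) +
      ∫⁻ w, ∫⁻ z, sᶜ.indicator 1 w * (‖stft gaussWindow f w‖ₑ * ‖stft gaussWindow f z‖ₑ *
        (q z * ‖stft gaussWindow gaussWindow (z - w)‖ₑ)) := by
  have hL := memLp_locOp hf hm
  have hFm := (aestronglyMeasurable_stft hf.1).enorm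
  have hWm := (aestronglyMeasurable_stft hL.1).enorm
  have h1m : Measurable (s.indicator (1 : ℝ × ℝ → ℝ≥0∞)) := measurable_one.indicator hs
  rw [← integral_stft_mul_conj hL hf]
  calc _ ≤ ∫⁻ w, ‖stft gaussWindow (locOp m gaussWindow f) w‖ₑ * ‖stft gaussWindow f w‖ₑ := by
        refine (enorm_integral_le_lintegral_enorm _).trans_eq (lintegral_congr fun w => ?_)
        rw [enorm_mul, RCLike.enorm_conj]
    _ ≤ ∫⁻ w, (δ⁻¹ * ‖stft gaussWindow (locOp m gaussWindow f) w‖ₑ ^ 2 +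
          δ * (s.indicator 1 w * ‖stft gaussWindow f w‖ₑ ^ 2) +
          ∫⁻ z, sᶜ.indicator 1 w * (‖stft gaussWindow f w‖ₑ * ‖stft gaussWindow f z‖ₑ *
            (q z * ‖stft gaussWindow gaussWindow (z - w)‖ₑ))) := by
        refine lintegral_mono fun w => ?_
        by_cases hw : w ∈ s
        · simp only [Set.indicator_of_mem hw, Pi.one_apply, one_mul]
          exact (ENNReal.mul_le_inv_mul_sq_add_mul_sq _ _ hδ hδ').trans le_self_add
        · simp only [Set.indicator_of_mem (Set.mem_compl hw), Pi.one_apply, one_mul]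
          refine le_trans ?_ le_add_self
          simp only [mul_assoc]
          rw [lintegral_const_mul' _ _ (by finiteness), mul_comm]
          gcongr
          refine (enorm_stft_locOp_le hf hm w).trans (lintegral_mono fun z => ?_)
          simp only [mul_assoc]
          gcongr
          exact hq z
    _ = _ := by
        have hm1 : AEMeasurable (fun w => δ⁻¹ *
            ‖stft gaussWindow (locOp m gaussWindow f) w‖ₑ ^ 2) volume :=
          (hWm.pow_const 2).const_mul _
        have hm2 : AEMeasurable (fun w => δ * (s.indicator 1 w * ‖stft gaussWindow f w‖ₑ ^ 2))
            volume := (h1m.aemeasurable.mul (hFm.pow_const 2)).const_mul _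
        rw [lintegral_add_left' (hm1.add hm2 : AEMeasurable (fun w => _ + _) volume),
          lintegral_add_left' hm1,
          lintegral_const_mul' _ _ (ENNReal.inv_ne_top.2 hδ), lintegral_const_mul' _ _ hδ',
          lintegral_sq_stft hL]

/-- Used with `u = w - γ` and `v = z - γ`: if `w` is farther than `2R` from `γ`, then `z` is farther
than `R` from `γ` or from `w`, so either the envelope or the Gaussian kernel is in its tail. -/
theorem indicator_lt_norm_mul_le {Q : ℝ × ℝ → ℝ≥0∞} {R : ℝ} (u v : ℝ × ℝ) :
    {y : ℝ × ℝ | ‖y‖ ≤ 2 * R}ᶜ.indicator 1 u * Q v ≤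
      {y : ℝ × ℝ | R < ‖y‖}.indicator Q v + {y : ℝ × ℝ | R < ‖y‖}.indicator 1 (v - u) * Q v := by
  by_cases hu : u ∈ {y : ℝ × ℝ | ‖y‖ ≤ 2 * R}ᶜ
  · rw [Set.indicator_of_mem hu, Pi.one_apply, one_mul]
    by_cases hv : v ∈ {y : ℝ × ℝ | R < ‖y‖}
    · rw [Set.indicator_of_mem hv]
      exact le_self_add
    · have hvu : v - u ∈ {y : ℝ × ℝ | R < ‖y‖} := by
        simp only [Set.mem_ofPred_eq, Set.mem_compl_iff, not_le, not_lt] at hu hv ⊢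
        have := norm_sub_le v (v - u)
        rw [sub_sub_cancel] at this
        linarith
      rw [Set.indicator_of_mem hvu, Pi.one_apply, one_mul]
      exact le_add_self
  · rw [Set.indicator_of_notMem hu, zero_mul]
    exact zero_le

/-- The contributions far from the respective `γ` are controlled by a convolution kernel. -/
theorem tsum_far_le {Γ : Set (ℝ × ℝ)} [Countable Γ] {Q : ℝ × ℝ → ℝ≥0∞} (hQ : Measurable Q)
    {S ε : ℝ≥0∞} (hS : ∀ z : ℝ × ℝ, ∑' γ : Γ, Q (z - γ) ≤ S) {R : ℝ}
    (hR : ∀ z : ℝ × ℝ, ∑' γ : Γ, {y : ℝ × ℝ | R < ‖y‖}.indicator Q (z - γ) ≤ ε)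
    {u G : ℝ × ℝ → ℝ≥0∞} (hu : AEMeasurable u volume) (hG : Measurable G) :
    ∑' γ : Γ, ∫⁻ w, ∫⁻ z, {y : ℝ × ℝ | ‖y‖ ≤ 2 * R}ᶜ.indicator 1 (w - γ) *
        (u w * u z * (Q (z - γ) * G (z - w))) ≤
      2 * (∫⁻ z, u z ^ 2) *
        (ε * (∫⁻ y, G y) + S * ∫⁻ y, {y : ℝ × ℝ | R < ‖y‖}.indicator G y) := by
  have hsR : MeasurableSet {y : ℝ × ℝ | R < ‖y‖} := measurableSet_lt measurable_const measurable_norm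
  have hs2R : MeasurableSet {y : ℝ × ℝ | ‖y‖ ≤ 2 * R} :=
    measurableSet_le measurable_norm measurable_const
  have h1 : Measurable ({y : ℝ × ℝ | ‖y‖ ≤ 2 * R}ᶜ.indicator (1 : ℝ × ℝ → ℝ≥0∞)) :=
    measurable_one.indicator hs2R.compl
  have hT : ∀ γ : Γ, AEMeasurable (fun p : (ℝ × ℝ) × (ℝ × ℝ) =>
      {y : ℝ × ℝ | ‖y‖ ≤ 2 * R}ᶜ.indicator 1 (p.1 - γ) *
        (u p.1 * u p.2 * (Q (p.2 - γ) * G (p.2 - p.1)))) (volume.prod volume) := fun γ =>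
    (Measurable.aemeasurable (by fun_prop)).mul
      ((hu.comp_fst.mul hu.comp_snd).mul (Measurable.aemeasurable (by fun_prop)))
  have hT' : ∀ (γ : Γ) (w : ℝ × ℝ), AEMeasurable (fun z : ℝ × ℝ =>
      {y : ℝ × ℝ | ‖y‖ ≤ 2 * R}ᶜ.indicator 1 (w - γ) *
        (u w * u z * (Q (z - γ) * G (z - w)))) volume := fun γ w =>
    ((hu.const_mul _).mul (Measurable.aemeasurable (by fun_prop))).const_mul _
  -- The first term collects envelope tails, whose sum over `γ` is at most `ε`; the second collects
  -- kernel tails, with the full envelope sum `S`.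
  set k : ℝ × ℝ → ℝ≥0∞ := fun y => ε * G y + S * {y : ℝ × ℝ | R < ‖y‖}.indicator G y with hk
  have hkm : Measurable k := (hG.const_mul _).add ((hG.indicator hsR).const_mul _)
  have hkint : ∫⁻ y, k y = ε * (∫⁻ y, G y) + S * ∫⁻ y, {y : ℝ × ℝ | R < ‖y‖}.indicator G y := by
    rw [hk, lintegral_add_left (hG.const_mul _), lintegral_const_mul _ hG,
      lintegral_const_mul _ (hG.indicator hsR)]
  rw [← hkint]
  refine le_trans ?_ (lintegral_lintegral_mul_mul_sub_le hu hkm)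
  rw [← lintegral_tsum fun γ => (hT γ).lintegral_prod_right']
  refine lintegral_mono fun w => ?_
  simp only
  rw [← lintegral_tsum fun γ => hT' γ w]
  refine lintegral_mono fun z => ?_
  simp only
  calc ∑' γ : Γ, {y : ℝ × ℝ | ‖y‖ ≤ 2 * R}ᶜ.indicator 1 (w - γ) *
        (u w * u z * (Q (z - γ) * G (z - w)))
      = u w * u z * G (z - w) *
        ∑' γ : Γ, {y : ℝ × ℝ | ‖y‖ ≤ 2 * R}ᶜ.indicator 1 (w - γ) * Q (z - γ) := by
        rw [← ENNReal.tsum_mul_left]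
        refine tsum_congr fun γ => ?_
        ring
    _ ≤ u w * u z * G (z - w) * (ε + {y : ℝ × ℝ | R < ‖y‖}.indicator 1 (z - w) * S) := by
        gcongr
        calc _ ≤ ∑' γ : Γ, ({y : ℝ × ℝ | R < ‖y‖}.indicator Q (z - γ) +
              {y : ℝ × ℝ | R < ‖y‖}.indicator 1 (z - w) * Q (z - γ)) := by
              refine ENNReal.tsum_le_tsum fun γ => ?_
              refine (indicator_lt_norm_mul_le (R := R) (Q := Q) (w - γ) (z - γ)).trans_eq ?_
              rw [sub_sub_sub_cancel_right]
          _ ≤ _ := by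
              rw [ENNReal.tsum_add, ENNReal.tsum_mul_left]
              gcongr
              · exact hR z
              · exact hS z
    _ = u w * u z * k (z - w) := by
        rw [hk, mul_assoc]
        congr 1
        by_cases hzw : z - w ∈ {y : ℝ × ℝ | R < ‖y‖}
        · simp only [Set.indicator_of_mem hzw, Pi.one_apply]
          ring
        · simp only [Set.indicator_of_notMem hzw]
          ring

theorem ENNReal.le_of_le_add_half_mul {a x y : ℝ≥0∞} (hx : a * x ≠ ∞)
    (h : a * x ≤ y + a / 2 * x) : a / 2 * x ≤ y := by
  have hx2 : a / 2 * x ≠ ∞ := by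
    refine ne_top_of_le_ne_top hx ?_
    gcongr
    exact ENNReal.half_le_self
  refine (ENNReal.add_le_add_iff_right hx2).1 ?_
  rwa [← add_mul, ENNReal.add_halves]

/-- Lower frame bound for localization operators with Gaussian window. -/
theorem exists_mul_le_tsum_lintegral_sq_locOp {Γ : Set (ℝ × ℝ)} (hΓ : RelativelySeparated Γ)
    {η : Γ → ℝ × ℝ → ℝ} (hη : ∀ γ, Integrable (η γ) volume) {C s : ℝ} (hC : 0 ≤ C) (hs : 1 < s)
    (henv : ∀ (γ : Γ) (ξ : ℝ × ℝ), ‖η γ ξ‖ₑ ≤ decayProfile C s (ξ - γ)) {a : ℝ} (ha : 0 < a)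
    (hsum : ∀ z, a ≤ ∑' γ, η γ z) :
    ∃ A : ℝ≥0∞, A ≠ 0 ∧ A ≠ ∞ ∧ ∀ f : ℝ → ℂ, MemLp f 2 volume →
      A * ∫⁻ t, ‖f t‖ₑ ^ 2 ≤ ∑' γ, ∫⁻ t, ‖locOp (η γ) gaussWindow f t‖ₑ ^ 2 := by
  have := hΓ.countable.to_subtype
  set α := ENNReal.ofReal a with hα
  have hα0 : α ≠ 0 := (ENNReal.ofReal_pos.2 ha).ne'
  have hαt : α ≠ ∞ := ENNReal.ofReal_ne_top
  set Q := decayProfile C s with hQ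
  have hQm : Measurable Q := measurable_decayProfile C s
  set G : ℝ × ℝ → ℝ≥0∞ := fun z => ‖stft gaussWindow gaussWindow z‖ₑ with hG
  have hGm : Measurable G := measurable_enorm_stft_gaussWindow
  have hGt : ∫⁻ z, G z ≠ ∞ := by
    have := integrable_norm_stft_gaussWindow.2
    simpa only [HasFiniteIntegral, enorm_norm] using this.ne
  obtain ⟨S, hSt, hS⟩ := exists_tsum_decayProfile_le hΓ hC hs
  -- Each of the two far contributions is to be at most `α / 16`; with the factor 2 from Schur's
  -- test they total `α / 4`.
  set ε := α / 16 / ∫⁻ z, G z with hε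
  have hε0 : 0 < ε := ENNReal.div_pos (ENNReal.div_ne_zero.2 ⟨hα0, by simp⟩) hGt
  have hlim := ENNReal.Tendsto.const_mul (a := S) (tendsto_lintegral_indicator_lt_norm hGm hGt)
    (.inr hSt)
  rw [mul_zero] at hlim
  obtain ⟨n, hn1, hn2⟩ := ((exists_tsum_indicator_decayProfile_le hΓ hC hs hε0).and
    (hlim.eventually_le_const (ENNReal.div_pos hα0 (by simp : (16 : ℝ≥0∞) ≠ ∞)))).exists
  obtain ⟨M, hMt, hM⟩ := exists_tsum_indicator_one_le hΓ (2 * n)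
  -- Chosen so that the near error is at most `α / 4` as well; `M + 1` avoids division by zero.
  set δ := α / 4 / (M + 1) with hδ
  have hM1 : M + 1 ≠ ∞ := ENNReal.add_ne_top.2 ⟨hMt, by simp⟩
  have hδ0 : δ ≠ 0 := ENNReal.div_ne_zero.2 ⟨ENNReal.div_ne_zero.2 ⟨hα0, by simp⟩, hM1⟩
  have hδt : δ ≠ ∞ := ENNReal.div_ne_top (ENNReal.div_ne_top hαt (by simp)) (by simp)
  have hδM : δ * M ≤ α / 4 := by
    calc δ * M ≤ δ * (M + 1) := by gcongr; exact le_self_add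
      _ ≤ α / 4 := (mul_comm _ _).trans_le ENNReal.mul_div_le
  refine ⟨δ * (α / 2), mul_ne_zero hδ0 (ENNReal.div_ne_zero.2 ⟨hα0, by simp⟩),
    ENNReal.mul_ne_top hδt (ENNReal.div_ne_top hαt (by simp)), fun f hf => ?_⟩
  set E := ∫⁻ t, ‖f t‖ₑ ^ 2 with hE
  have hEt : E ≠ ∞ := hf.lintegral_sq_lt_top.ne
  have hF2 := (aestronglyMeasurable_stft hf.1).enorm.pow_const 2
  have hFE : ∫⁻ z, ‖stft gaussWindow f z‖ₑ ^ 2 = E := lintegral_sq_stft hf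
  set H := ∑' γ, ∫⁻ t, ‖locOp (η γ) gaussWindow f t‖ₑ ^ 2 with hH
  set B : Set (ℝ × ℝ) := {y | ‖y‖ ≤ 2 * n} with hB
  have hBm : MeasurableSet B := measurableSet_le measurable_norm measurable_const
  have hind : Measurable (B.indicator (1 : ℝ × ℝ → ℝ≥0∞)) := measurable_one.indicator hBm
  have hnear : ∑' γ : Γ, ∫⁻ w, B.indicator 1 (w - γ) * ‖stft gaussWindow f w‖ₑ ^ 2 ≤ M * E := by
    have hmeas : ∀ γ : Γ, AEMeasurable (fun w : ℝ × ℝ => B.indicator 1 (w - γ) *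
        ‖stft gaussWindow f w‖ₑ ^ 2) volume := fun γ =>
      (Measurable.aemeasurable (by fun_prop)).mul hF2
    rw [← lintegral_tsum hmeas]
    calc _ ≤ ∫⁻ w, M * ‖stft gaussWindow f w‖ₑ ^ 2 := by
          refine lintegral_mono fun w => ?_
          simp only
          rw [ENNReal.tsum_mul_right]
          gcongr
          exact hM w
      _ = _ := by rw [lintegral_const_mul' _ _ hMt, hFE]
  have hfar : ∑' γ : Γ, ∫⁻ w, ∫⁻ z, Bᶜ.indicator 1 (w - γ) * (‖stft gaussWindow f w‖ₑ *
      ‖stft gaussWindow f z‖ₑ * (Q (z - γ) * G (z - w))) ≤ α / 4 * E := by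
    refine (tsum_far_le hQm hS hn1 (aestronglyMeasurable_stft hf.1).enorm hGm).trans ?_
    rw [hFE]
    calc _ ≤ 2 * E * (α / 16 + α / 16) := by
          gcongr
          exact (mul_comm _ _).trans_le ENNReal.mul_div_le
      _ = α / 4 * E := by
          rw [ENNReal.div_eq_inv_mul, ENNReal.div_eq_inv_mul]
          have h16 : (16 : ℝ≥0∞)⁻¹ * 4 = 4⁻¹ := by
            rw [show (16 : ℝ≥0∞) = 4 * 4 by norm_num,
              ENNReal.mul_inv (by simp) (by simp), mul_assoc,
              ENNReal.inv_mul_cancel (by simp) (by simp), mul_one]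
          rw [← h16]
          ring
  have key : α * E ≤ δ⁻¹ * H + α / 2 * E := by
    calc α * E ≤ ∑' γ, ‖∫ t, locOp (η γ) gaussWindow f t * (starRingEnd ℂ) (f t)‖ₑ :=
          mul_le_tsum_enorm_integral_locOp hη hSt
            (fun z => (ENNReal.tsum_le_tsum fun γ => henv γ z).trans (hS z)) ha hsum hf
      _ ≤ ∑' γ : Γ, (δ⁻¹ * (∫⁻ t, ‖locOp (η γ) gaussWindow f t‖ₑ ^ 2) +
            δ * (∫⁻ w, B.indicator 1 (w - γ) * ‖stft gaussWindow f w‖ₑ ^ 2) +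
            ∫⁻ w, ∫⁻ z, Bᶜ.indicator 1 (w - γ) * (‖stft gaussWindow f w‖ₑ *
              ‖stft gaussWindow f z‖ₑ * (Q (z - γ) * G (z - w)))) :=
          ENNReal.tsum_le_tsum fun γ => enorm_integral_locOp_mul_conj_le hf (hη γ) (henv γ) hδ0 hδt
            (s := {w | w - (γ : ℝ × ℝ) ∈ B}) (hBm.preimage (measurable_sub_const _))
      _ ≤ δ⁻¹ * H + δ * (M * E) + α / 4 * E := by
          rw [ENNReal.tsum_add, ENNReal.tsum_add, ENNReal.tsum_mul_left, ENNReal.tsum_mul_left]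
          gcongr
      _ ≤ δ⁻¹ * H + α / 4 * E + α / 4 * E := by
          rw [← mul_assoc δ]
          gcongr
      _ = δ⁻¹ * H + α / 2 * E := by
          rw [add_assoc, ← add_mul]
          congr 2
          rw [show α / 4 = α / 2 / 2 by
            rw [ENNReal.div_eq_inv_mul, ENNReal.div_eq_inv_mul, ENNReal.div_eq_inv_mul, ← mul_assoc,
              ← ENNReal.mul_inv (by simp) (by simp)]; norm_num, ENNReal.add_halves]
  have h2 := ENNReal.le_of_le_add_half_mul (ENNReal.mul_ne_top hαt hEt) key
  calc δ * (α / 2) * E = δ * (α / 2 * E) := mul_assoc _ _ _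
    _ ≤ δ * (δ⁻¹ * H) := by gcongr
    _ = H := by rw [← mul_assoc, ENNReal.mul_inv_cancel hδ0 hδt, one_mul]

end LowerBound

/-! ### Windows close to the Gaussian -/

section Frame

theorem WellSpread.exists_decayProfile {Γ : Set (ℝ × ℝ)} {η : Γ → ℝ × ℝ → ℝ}
    (hη : WellSpread Γ η) : ∃ C s : ℝ, 0 ≤ C ∧ 1 < s ∧
      ∀ (γ : Γ) (ξ : ℝ × ℝ), ‖η γ ξ‖ₑ ≤ decayProfile C s (ξ - γ) := by
  obtain ⟨g, -, -, ⟨C, s, hs, hg⟩, hηg⟩ := hη.envelope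
  refine ⟨C, s, ?_, hs, fun γ ξ => ?_⟩
  · simpa [sqLen] using (abs_nonneg _).trans (hg 0)
  · rw [← ofReal_norm, Real.norm_eq_abs]
    exact ENNReal.ofReal_le_ofReal (((hηg γ ξ).trans (le_abs_self _)).trans (hg _))

/-- A window whose short-time Fourier transform is relatively close to that of the Gaussian is a
multiple of the Gaussian, with factor close to `1`. -/
theorem exists_smul_gaussWindow_of_close {φ : ℝ → ℂ} (hφ : MemLp φ 2 volume) {C₀ : ℝ}
    (h : ∀ z, ‖stft gaussWindow gaussWindow z - stft gaussWindow φ z‖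
      < C₀ * ‖stft gaussWindow gaussWindow z‖) :
    ∃ c : ℂ, φ =ᵐ[volume] c • gaussWindow ∧ ‖1 - c‖ < C₀ := by
  obtain ⟨c, hc⟩ := exists_ae_eq_smul_gaussWindow hφ (K := 1 + C₀) fun z => by
    have h1 := norm_le_norm_add_norm_sub (stft gaussWindow gaussWindow z) (stft gaussWindow φ z)
    linarith [h z]
  refine ⟨c, hc, ?_⟩
  have h0 := h 0
  rw [stft_congr_ae hc, stft_smul, Pi.smul_apply, smul_eq_mul, ← one_sub_mul, norm_mul] at h0
  exact lt_of_mul_lt_mul_right h0 (norm_nonneg _)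

/-- The operator depends quadratically on the window, so its squared norm picks up a fourth power of
`‖c‖`. -/
theorem eLpNorm_locOp_smul_gaussWindow {φ : ℝ → ℂ} {c : ℂ} (h : φ =ᵐ[volume] c • gaussWindow)
    (m : ℝ × ℝ → ℝ) (f : ℝ → ℂ) :
    eLpNorm (locOp m φ f) 2 volume ^ 2 =
      ENNReal.ofReal (‖c‖ ^ 4) * ∫⁻ t, ‖locOp m gaussWindow f t‖ₑ ^ 2 := by
  rw [locOp_smul_gaussWindow h, eLpNorm_const_smul, mul_pow, eLpNorm_two_sq, enorm_complex_ofReal,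
    ← ofReal_norm, ← ENNReal.ofReal_pow (norm_nonneg _), Real.norm_of_nonneg (by positivity),
    ← pow_mul]

theorem lintegral_sq_Lp (f : Lp ℂ 2 (volume : Measure ℝ)) :
    ∫⁻ t, ‖f t‖ₑ ^ 2 = ENNReal.ofReal (‖f‖ ^ 2) := by
  rw [← eLpNorm_two_sq, ← Lp.enorm_def, ENNReal.ofReal_pow (norm_nonneg _), ofReal_norm]

end Frame

/-! ### The frame inequality for the given windows -/

theorem mainTheorem3 {ι : Type*}
    (φ : ι → Lp ℂ 2 (volume : Measure ℝ))
    (C s : ℝ) (hs : 1 < s)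
    (hdecay : ∀ (i : ι) (z : ℝ × ℝ),
      absConv (stft gaussWindow (φ i)) z ≤ C * (1 + sqLen z) ^ (-s))
    (C₀ : ℝ)
    (hclose : ∀ (i : ι) (z : ℝ × ℝ),
      ‖stft gaussWindow gaussWindow z - stft gaussWindow (φ i) z‖
        < C₀ * ‖stft gaussWindow gaussWindow z‖)
    (hC₀ : 2 * C₀ < ∫ z : ℝ × ℝ, ‖stft gaussWindow gaussWindow z‖)
    (Γ : Set (ℝ × ℝ)) (η : Γ → ℝ × ℝ → ℝ) (hη : WellSpread Γ η)
    (hsum : ∃ a b : ℝ, 0 < a ∧ ∀ z : ℝ × ℝ, a ≤ ∑' γ : Γ, η γ z ∧ ∑' γ : Γ, η γ z ≤ b)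
    (i : Γ → ι) :
    ∃ A B : ℝ, 0 < A ∧ 0 < B ∧ ∀ f : Lp ℂ 2 (volume : Measure ℝ),
      (∀ γ : Γ, MemLp (locOp (η γ) (φ (i γ)) f) 2 volume) ∧
      ENNReal.ofReal (A * ‖f‖ ^ 2)
        ≤ ∑' γ : Γ, eLpNorm (locOp (η γ) (φ (i γ)) f) 2 volume ^ 2 ∧
      ∑' γ : Γ, eLpNorm (locOp (η γ) (φ (i γ)) f) 2 volume ^ 2
        ≤ ENNReal.ofReal (B * ‖f‖ ^ 2) := by
  rw [integral_norm_stft_gaussWindow] at hC₀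
  have hC₁ : 0 < 1 - C₀ := by linarith
  obtain ⟨a, b, ha, hab⟩ := hsum
  obtain ⟨C', s', hC', hs', henv⟩ := hη.exists_decayProfile
  have hΓ := hη.relativelySeparated
  have := hΓ.countable.to_subtype
  choose c hc hc1 using fun j => exists_smul_gaussWindow_of_close (Lp.memLp (φ j)) (hclose j)
  obtain ⟨A, hA0, hAt, hA⟩ := exists_mul_le_tsum_lintegral_sq_locOp hΓ hη.integrable hC' hs' henv ha
    fun z => (hab z).1
  obtain ⟨S, hSt, hS⟩ := exists_tsum_decayProfile_le hΓ hC' hs'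
  have hlow : ∀ j, 1 - C₀ ≤ ‖c j‖ := fun j => by
    have := norm_le_norm_add_norm_sub (c j) (1 : ℂ)
    rw [norm_one, norm_sub_rev] at this
    linarith [hc1 j, norm_sub_rev (c j) 1]
  have hupp : ∀ j, ‖c j‖ ≤ 2 := fun j => by
    have := norm_le_norm_add_norm_sub (1 : ℂ) (c j)
    rw [norm_one] at this
    linarith [hc1 j]
  have hBt : ENNReal.ofReal (2 ^ 4) * (4 * S ^ 2) ≠ ∞ := by finiteness
  -- The fourth powers come from `1 - C₀ ≤ ‖c j‖ ≤ 2`; the added 1 only ensures that the upper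
  -- constant is positive.
  refine ⟨(1 - C₀) ^ 4 * A.toReal, (ENNReal.ofReal (2 ^ 4) * (4 * S ^ 2)).toReal + 1,
    mul_pos (pow_pos hC₁ 4) (ENNReal.toReal_pos hA0 hAt),
    add_pos_of_nonneg_of_pos ENNReal.toReal_nonneg one_pos, fun f => ⟨fun γ => ?_, ?_, ?_⟩⟩
  · rw [locOp_smul_gaussWindow (hc (i γ))]
    exact (memLp_locOp (Lp.memLp f) (hη.integrable γ)).const_smul _
  · simp_rw [fun γ => eLpNorm_locOp_smul_gaussWindow (hc (i γ)) (η γ) f]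
    calc _ = ENNReal.ofReal ((1 - C₀) ^ 4) * (A * ∫⁻ t, ‖f t‖ₑ ^ 2) := by
          rw [lintegral_sq_Lp, mul_assoc, ENNReal.ofReal_mul (by positivity),
            ENNReal.ofReal_mul ENNReal.toReal_nonneg, ENNReal.ofReal_toReal hAt]
      _ ≤ ENNReal.ofReal ((1 - C₀) ^ 4) * ∑' γ, ∫⁻ t, ‖locOp (η γ) gaussWindow f t‖ₑ ^ 2 := by
          gcongr
          exact hA f (Lp.memLp f)
      _ ≤ _ := by
          rw [← ENNReal.tsum_mul_left]
          refine ENNReal.tsum_le_tsum fun γ => ?_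
          gcongr
          exact hlow (i γ)
  · simp_rw [fun γ => eLpNorm_locOp_smul_gaussWindow (hc (i γ)) (η γ) f]
    calc _ ≤ ENNReal.ofReal (2 ^ 4) * ∑' γ, ∫⁻ t, ‖locOp (η γ) gaussWindow f t‖ₑ ^ 2 := by
          rw [← ENNReal.tsum_mul_left]
          refine ENNReal.tsum_le_tsum fun γ => ?_
          gcongr
          exact hupp (i γ)
      _ ≤ ENNReal.ofReal (2 ^ 4) * (4 * S ^ 2 * ∫⁻ t, ‖f t‖ₑ ^ 2) := by
          gcongr
          exact tsum_lintegral_sq_locOp_le hη.integrable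
            (fun z => (ENNReal.tsum_le_tsum fun γ => henv γ z).trans (hS z)) (Lp.memLp f)
      _ ≤ _ := by
          rw [lintegral_sq_Lp, ENNReal.ofReal_mul (by positivity), ← mul_assoc,
            ENNReal.ofReal_add ENNReal.toReal_nonneg zero_le_one, ENNReal.ofReal_toReal hBt]
          gcongr
          exact le_self_add
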